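/- **Setting.** A market has buyers $N=\{1,\dots,n\}$ and sellers $M=\{1,\dots,m\}$ ($n,m\ge 1$) and an edge set $E\subseteq N\times M$; $E_i$, $E_j$ denote the edges at buyer $i$, seller $j$. Each seller $j$ has a monotone submodular $f_j:2^{E_j}\to\mathbb R_+$ with $f_j(\emptyset)=0$; $P$ is the set of $w\in\mathbb R_+^E$ with $w(F)\le f_j(F)$ for all $j\in M$ and $F\subseteq E_j$. Buyer $i$ has valuation $v_i>0$ per unit and budget $B_i\in[0,\infty]$; seller $j$ has valuation $\rho_j>0$ per unit. An allocation $(w,p,r)$ consists of transactions $w$, nonnegative payments $p_i$ and nonnegative revenues $r_j$; it is feasible if $w\in P$ and $p_i\le B_i$ for all $i$. Its liquid welfare is $$\mathrm{LW}=\sum_{i\in N}\min\bigl(v_i\,w(E_i),B_i\bigr)+\sum_{j\in M}\rho_j\bigl(f_j(E_j)-w(E_j)\bigr),$$ and $\mathrm{LW}^{\mathrm{OPT}}$ is the maximum of $\mathrm{LW}$ over feasible allocations. **Polyhedral Clinching Auction with step $\varepsilon>0$** (all participants report truthfully). For each seller $j$ add a virtual buyer $n+j$, adjacent to $j$ only,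 with valuation $\rho_j$ and budget $\infty$, and put $f_j(F):=f_j(E_j)$ (the old total) if $F$ contains the new edge; $N,E,P$ now refer to this modified market. Start with $w=p=r=0$, prices $c_i=0$, demands $d_i=\infty$, $l=1$. While some $d_i\ne 0$: 1. For $i=1,\dots,n+m$ in turn: buyer $i$ clinches a (componentwise) maximal vector $\xi_i\in\mathbb R_+^{E_i}$ with $P^i_{w,d}(\xi_i)=P^i_{w,d}(0)$, where $P^i_{w,d}(\xi)$ is the set of vectors $(y(E_k))_{k\ne i}$ over all $y\in\mathbb R_+^E$ with $w+y\in P$, $y(E_k)\le d_k$ for all $k$, and $y|_{E_i}=\xi$. Then $w_{ij}$ is increased by $\xi_{ij}$, $p_i$ by $c_i\xi_i(E_i)$, $r_j$ by $c_i\xi_{ij}$, and $d_i$ is reset to $(B_i-p_i)/c_i$ if $c_i<v_i$ (read as $\infty$ if $c_i=0$) and to $0$ otherwise. 2. $c_l$ is increased by $\varepsilon$, $d_l$ is reset by the same formula, and $l$ moves cyclically to the next buyer. At the end all transactions of virtual buyers are cancelled ($r_j$ is decreased by $p_{n+j}$). Maximal vectors need not be unique; an outcome is any allocation obtained by some choice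 of them. **Theorem.** Suppose that all $v_i$ and $\rho_j$ are integer multiples of $\varepsilon$. Let $v_{\min}$, $v_{\max}$ be the minimum and maximum of the $v_i$ ($i\in N$) and $\rho_j$ ($j\in M$) together. If $\varepsilon\le \dfrac{v_{\min}^2}{v_{\max}-v_{\min}}$ (no condition if $v_{\max}=v_{\min}$), then $\mathrm{LW}^{\mathrm{OPT}}$ exists, the auction has an outcome, and every outcome has liquid welfare $\mathrm{LW}^{\mathrm{PCA}}\ge\frac12\mathrm{LW}^{\mathrm{OPT}}$. The bound and the condition are tight: for all $\varepsilon>0$ and all positive integer multiples $v_{\min}<v_{\max}$ of $\varepsilon$ there is a market with two buyers, one seller and valuations that are multiples of $\varepsilon$ with this minimum and maximum, such that the auction has an outcome and every outcome satisfies $\mathrm{LW}^{\mathrm{PCA}}>0$ and $$\mathrm{LW}^{\mathrm{PCA}}=\tfrac12\mathrm{LW}^{\mathrm{OPT}}\ \text{ if }\ \varepsilon=\tfrac{v_{\min}^2}{v_{\max}-v_{\min}},\qquad \mathrm{LW}^{\mathrm{PCA}}<\tfrac12\mathrm{LW}^{\mathrm{OPT}}\ \text{ if }\ \varepsilon>\tfrac{v_{\min}^2}{v_{\max}-v_{\min}}.$$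 -/

import Mathlib

open scoped ENNReal

/-- A two-sided market with buyers `N` and sellers `M`. The edge set is
`E = {(i, j) | i ∈ nbr j}`, so the set `E_j` of edges at seller `j` is identified with the set
`nbr j` of buyers adjacent to `j`. The goods of seller `j` are constrained by the polymatroid of
the monotone submodular function `f j : 2^{E_j} → ℝ₊`; values of `f j` outside `2^{E_j}` are
never used. -/
structure Market (N M : Type) [DecidableEq N] where
  nbr : M → Finset N
  f : M → Finset N → ℝ
  f_empty : ∀ j, f j ∅ = 0
  f_mono : ∀ j, ∀ S T : Finset N, S ⊆ T → T ⊆ nbr j → f j S ≤ f j T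
  f_submod : ∀ j, ∀ S T : Finset N, S ⊆ nbr j → T ⊆ nbr j →
    f j (S ∪ T) + f j (S ∩ T) ≤ f j S + f j T

/-- An allocation: transactions `w i j`, payments of the buyers, revenues of the sellers. -/
structure Allocation (N M : Type) where
  w : N → M → ℝ
  p : N → ℝ
  r : M → ℝ

namespace Market

section General

variable {N M : Type} [Fintype N] [Fintype M] [DecidableEq N] (G : Market N M)

/-- The polytope `P = ⨁ P_j` of feasible transactions. A vector of `ℝ^E` is a function
`N → M → ℝ` that vanishes off the edges. -/
def polytope : Set (N → M → ℝ) :=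
  {w | (∀ i j, 0 ≤ w i j) ∧ (∀ i j, i ∉ G.nbr j → w i j = 0) ∧
    ∀ j, ∀ F : Finset N, F ⊆ G.nbr j → ∑ i ∈ F, w i j ≤ G.f j F}

/-- An allocation is feasible if it is nonnegative, satisfies the polymatroid constraints and no
buyer pays more than her budget. A budget may be infinite. -/
def Feasible (B : N → ℝ≥0∞) (A : Allocation N M) : Prop :=
  A.w ∈ G.polytope ∧ (∀ i, 0 ≤ A.p i) ∧ (∀ j, 0 ≤ A.r j) ∧ ∀ i, ENNReal.ofReal (A.p i) ≤ B i

/-- Liquid welfare `∑ᵢ min (vᵢ xᵢ, Bᵢ) + ∑ⱼ ρⱼ xⱼ`, where `xᵢ` is the amount that buyer `i` gets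
and `xⱼ = f_j(E_j) - ∑ᵢ wᵢⱼ` is the amount that seller `j` keeps. -/
noncomputable def liquidWelfare (v : N → ℝ) (ρ : M → ℝ) (B : N → ℝ≥0∞)
    (A : Allocation N M) : ℝ :=
  ∑ i, (min (ENNReal.ofReal (v i * ∑ j, A.w i j)) (B i)).toReal +
    ∑ j, ρ j * (G.f j (G.nbr j) - ∑ i, A.w i j)

/-- `L` is the optimal liquid welfare: the maximum over all feasible allocations. -/
def IsOptLW (v : N → ℝ) (ρ : M → ℝ) (B : N → ℝ≥0∞) (L : ℝ) : Prop :=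
  IsGreatest (G.liquidWelfare v ρ B '' {A | G.Feasible B A}) L

/-- The remnant supply polytope `P_{w,d}`. -/
def remnant (w : N → M → ℝ) (d : N → ℝ≥0∞) : Set (N → M → ℝ) :=
  {y | (∀ i j, 0 ≤ y i j) ∧ (∀ i j, i ∉ G.nbr j → y i j = 0) ∧ w + y ∈ G.polytope ∧
    ∀ i, ENNReal.ofReal (∑ j, y i j) ≤ d i}

/-- The set `P^i_{w,d}(ξ)` of possible future trade amounts of the buyers other than `i`, when
buyer `i` takes exactly `ξ`. -/
def future (w : N → M → ℝ) (d : N → ℝ≥0∞) (i : N) (ξ : M → ℝ) : Set ({k : N // k ≠ i} → ℝ) :=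
  {u | ∃ y ∈ G.remnant w d, y i = ξ ∧ ∀ k : {k : N // k ≠ i}, ∑ j, y k j = u k}

/-- The clinching polytope `P^i_{w,d}` of buyer `i`: the vectors `ξ ∈ ℝ₊^{E_i}` that leave the
possibilities of all other buyers unchanged. -/
def clinchPolytope (w : N → M → ℝ) (d : N → ℝ≥0∞) (i : N) : Set (M → ℝ) :=
  {ξ | (∀ j, 0 ≤ ξ j) ∧ (∀ j, i ∉ G.nbr j → ξ j = 0) ∧ G.future w d i ξ = G.future w d i 0}

end General

/-- The modified market: each seller `j` gets a virtual buyer `Sum.inr j`, adjacent to `j` only,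
and `f_j(F) := f_j(E_j)` as soon as `F` contains the virtual buyer of `j`. -/
def withVirtual {N M : Type} [DecidableEq N] [DecidableEq M] (G : Market N M) :
    Market (N ⊕ M) M where
  nbr j := (G.nbr j).disjSum {j}
  f j F := if Sum.inr j ∈ F then G.f j (G.nbr j) else G.f j F.toLeft
  f_empty j := by
    have h : (∅ : Finset (N ⊕ M)).toLeft = ∅ := by ext; simp
    simp [h, G.f_empty]
  f_mono j S T hST hT := by
    have hl : T.toLeft ⊆ G.nbr j := by
      intro a ha
      simpa using hT (Finset.mem_toLeft.1 ha)
    have hs : S.toLeft ⊆ T.toLeft := Finset.toLeft_subset_toLeft hST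
    by_cases h1 : Sum.inr j ∈ S
    · simp [h1, hST h1]
    · by_cases h2 : Sum.inr j ∈ T
      · simpa [h1, h2] using G.f_mono j _ _ (hs.trans hl) subset_rfl
      · simpa [h1, h2] using G.f_mono j _ _ hs hl
  f_submod j S T hS hT := by
    have hSl : S.toLeft ⊆ G.nbr j := by
      intro a ha
      simpa using hS (Finset.mem_toLeft.1 ha)
    have hTl : T.toLeft ⊆ G.nbr j := by
      intro a ha
      simpa using hT (Finset.mem_toLeft.1 ha)
    have hu : (S ∪ T).toLeft = S.toLeft ∪ T.toLeft := by ext; simp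
    have hi : (S ∩ T).toLeft = S.toLeft ∩ T.toLeft := by ext; simp
    by_cases h1 : Sum.inr j ∈ S <;> by_cases h2 : Sum.inr j ∈ T
    · simp [h1, h2]
    · have := G.f_mono j (S.toLeft ∩ T.toLeft) _ (Finset.inter_subset_right) hTl
      simpa [h1, h2, hi] using this
    · have := G.f_mono j (S.toLeft ∩ T.toLeft) _ (Finset.inter_subset_left) hSl
      simp only [h1, h2, hi, Finset.mem_union, Finset.mem_inter, or_true, and_true, if_true,
        if_false]
      linarith
    · simpa [h1, h2, hu, hi] using G.f_submod j _ _ hSl hTl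

end Market

namespace PCA

/-- The state of the auction: transactions, payments, revenues, price clocks and demands. -/
structure State (N M : Type) extends Allocation N M where
  c : N → ℝ
  d : N → ℝ≥0∞

/-- The initial state: nothing is allocated, prices are zero and demands are infinite. -/
def State.init (N M : Type) : State N M where
  w := 0
  p := 0
  r := 0
  c := 0
  d := fun _ => ⊤

/-- The demand of a buyer with budget `B`, bid `b` and payment `p` so far at price `c`, namely
`(B - p) / c` if `c < b` and `0` otherwise. The demand at price zero is infinite. -/
noncomputable def demand (B : ℝ≥0∞) (b p c : ℝ) : ℝ≥0∞ :=
  if c < b then (if c = 0 then ⊤ else (B - ENNReal.ofReal p) / ENNReal.ofReal c) else 0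

section General

variable {N M : Type} [Fintype N] [Fintype M] [DecidableEq N] (G : Market N M)
  (b : N → ℝ) (B : N → ℝ≥0∞)

/-- Buyer `i` clinches a maximal vector `ξ` of her clinching polytope at her price `c i`, and her
demand is updated. Every choice of a maximal vector is allowed. -/
def Clinch (i : N) (s s' : State N M) : Prop :=
  ∃ ξ : M → ℝ, Maximal (fun η => η ∈ G.clinchPolytope s.w s.d i) ξ ∧
    s' = { w := Function.update s.w i (s.w i + ξ)
           p := Function.update s.p i (s.p i + s.c i * ∑ j, ξ j)
           r := fun j => s.r j + s.c i * ξ j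
           c := s.c
           d := Function.update s.d i
             (demand (B i) (b i) (s.p i + s.c i * ∑ j, ξ j) (s.c i)) }

/-- The buyers in a list clinch one after the other. -/
inductive ClinchAll : List N → State N M → State N M → Prop
  | nil (s : State N M) : ClinchAll [] s s
  | cons {i : N} {L : List N} {s s' s'' : State N M} (h : Clinch G b B i s s')
      (hL : ClinchAll L s' s'') : ClinchAll (i :: L) s s''

/-- The price clock of buyer `l` is raised by `ε` and her demand is updated. -/
noncomputable def raise (ε : ℝ) (l : N) (s : State N M) : State N M :=
  { s with
    c := Function.update s.c l (s.c l + ε)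
    d := Function.update s.d l (demand (B l) (b l) (s.p l) (s.c l + ε)) }

end General

/-- All buyers of the modified market in the order `1, …, n, n + 1, …, n + m`. -/
def buyerOrder (n m : ℕ) : List (Fin n ⊕ Fin m) :=
  (List.finRange (n + m)).map finSumFinEquiv.symm

/-- `Reach G b B ε t s`: in a market with virtual buyers, bids `b` and budgets `B`, the state `s`
can arise after `t` iterations of the main loop. In iteration `t`, which takes place only if some
demand is nonzero, all buyers clinch and then the clock of the buyer with (zero-based) number
`t mod (n + m)` is raised. -/
inductive Reach {n m : ℕ} (G : Market (Fin n ⊕ Fin m) (Fin m)) (b : Fin n ⊕ Fin m → ℝ)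
    (B : Fin n ⊕ Fin m → ℝ≥0∞) (ε : ℝ) : ℕ → State (Fin n ⊕ Fin m) (Fin m) → Prop
  | init : Reach G b B ε 0 (State.init _ _)
  | step {t : ℕ} {s s' : State (Fin n ⊕ Fin m) (Fin m)} {l : Fin n ⊕ Fin m}
      (hs : Reach G b B ε t s) (hd : ∃ i, s.d i ≠ 0)
      (hc : ClinchAll G b B (buyerOrder n m) s s')
      (hl : (finSumFinEquiv l : ℕ) = t % (n + m)) :
      Reach G b B ε (t + 1) (raise b B ε l s')

/-- The final allocation: the transactions of the virtual buyers are cancelled. -/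
def State.output {n m : ℕ} (s : State (Fin n ⊕ Fin m) (Fin m)) : Allocation (Fin n) (Fin m) where
  w := fun i j => s.w (Sum.inl i) j
  p := fun i => s.p (Sum.inl i)
  r := fun j => s.r j - s.p (Sum.inr j)

/-- `A` is an outcome of the Polyhedral Clinching Auction in the market `G`, with buyers' bids
`b`, sellers' bids `σ`, budgets `B` and step size `ε`. The virtual buyer of seller `j` bids `σ j`
and has an infinite budget. -/
def Outcome {n m : ℕ} (G : Market (Fin n) (Fin m)) (b : Fin n → ℝ) (σ : Fin m → ℝ)
    (B : Fin n → ℝ≥0∞) (ε : ℝ) (A : Allocation (Fin n) (Fin m)) : Prop :=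
  ∃ t s, Reach G.withVirtual (Sum.elim b σ) (Sum.elim B fun _ => ⊤) ε t s ∧
    (∀ i, s.d i = 0) ∧ A = s.output

/-- All valuations (of the buyers and of the virtual buyers) are positive multiples of `ε`. -/
def Admissible {n m : ℕ} (v : Fin n → ℝ) (ρ : Fin m → ℝ) (ε : ℝ) : Prop :=
  0 < ε ∧ ∀ i, 0 < Sum.elim v ρ i ∧ ∃ k : ℕ, Sum.elim v ρ i = k * ε

/-- The smallest valuation among buyers and virtual buyers. -/
noncomputable def vmin {n m : ℕ} (v : Fin n → ℝ) (ρ : Fin m → ℝ) : ℝ := ⨅ i, Sum.elim v ρ i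

/-- The largest valuation among buyers and virtual buyers. -/
noncomputable def vmax {n m : ℕ} (v : Fin n → ℝ) (ρ : Fin m → ℝ) : ℝ := ⨆ i, Sum.elim v ρ i

end PCA

/-!
The auction never loses more than the liquid welfare that it achieves. This is shown by following a
potential. At every moment fix a *base* `u`: a way to distribute all goods not yet sold among the
buyers (virtual ones included) that respects supply and demands. A buyer with valuation `v` and
budget `B` is satiated by `κ = B / v` units. In the potential, her units up to `κ` are worth `v`
each, and further units are worth `c + ε` each, where `c` is the price at which they were bought, or
the current price if they are still to be bought. If `B` is finite, the units up to `κ` that she has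
already bought also count the excess of their price over the minimum `vmin` of all valuations.
Initially, the transactions of an optimal allocation give a base whose potential is at least the
optimal liquid welfare.

* Clinching does not reduce the potential: if `i` clinches `ξ`, subtracting `ξ` from her share of `u`
  gives a base again (`Market.IsBase.clinch`), by the very definition of the clinching polytope.
* Raising the price of `l` does not either: as all buyers have just clinched maximal vectors,
  the others could buy everything that is left (`Market.exists_base_eq_zero_of_maximal`). Hence they
  can take over all units which `l` can no longer afford (`Market.IsBase.exists_drop`). Such a unit
  was worth at most `c l + ε` to `l`, and is worth at least `c k + ε ≥ c l + ε` to the buyer `k` who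
  takes it over, since `l` has the lowest price (`PCA.potential_raise`).

In the end everything is sold and the potential exceeds the liquid welfare by at most the payments
of the buyers with finite budgets, plus `ε` for each unit beyond satiation, minus `vmin` for each of
their units up to satiation. A real buyer pays at least `vmin` for each unit, because the virtual
buyer of a seller blocks all clinching from this seller until her price reaches her valuation
(`Market.clinch_eq_zero_of_virtual`). This bounds the number of units beyond satiation, and under
the condition on `ε` the charge of `ε` for them is at most `vmin * κ`. Hence the potential is at
most twice the liquid welfare (`PCA.buyerPotential_final_le`).

Statements on amounts of goods are reduced to a single polymatroid on the set of buyers, whose rank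
function `Market.supply` is the sum of the residual rank functions of the sellers. That this loses
nothing (`Market.mem_cappedPolymatroid_supply_iff`) is the decomposition theorem for sums of
polymatroids, `exists_sum_of_mem_polymatroid_sum`, which is proved by splitting one coordinate at a
time.

For tightness, take one divisible good and let the valuations be `a + ε` and `b` for the buyers and
`a` for the seller. The first buyer has an infinite budget and the second one has the budget `a`.
The first buyer and the virtual buyer drop out while the price of the second buyer is still `a`, so
she gets the whole good for `a`, although the fraction `a / b` would satiate her.
-/

/-! ### Polymatroids -/

section Polymatroid

variable {N : Type} [DecidableEq N]

/-- `h` is the rank function of a polymatroid on the ground set `N`: a normalized, monotone and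
submodular set function. -/
structure IsPolymatroidRank (h : Finset N → ℝ) : Prop where
  empty : h ∅ = 0
  mono : ∀ S T, S ⊆ T → h S ≤ h T
  submod : ∀ S T, h (S ∪ T) + h (S ∩ T) ≤ h S + h T

/-- The polymatroid with rank function `h`. -/
def polymatroid (h : Finset N → ℝ) : Set (N → ℝ) :=
  {u | (∀ k, 0 ≤ u k) ∧ ∀ S, ∑ k ∈ S, u k ≤ h S}

/-- The vectors of the polymatroid with rank function `h` that respect the capacities `d`. -/
def cappedPolymatroid (h : Finset N → ℝ) (d : N → ℝ≥0∞) : Set (N → ℝ) :=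
  {u | u ∈ polymatroid h ∧ ∀ k, ENNReal.ofReal (u k) ≤ d k}

theorem IsPolymatroidRank.sum {M : Type} {f : M → Finset N → ℝ} (J : Finset M)
    (hf : ∀ j, IsPolymatroidRank (f j)) : IsPolymatroidRank (fun S => ∑ j ∈ J, f j S) where
  empty := Finset.sum_eq_zero fun j _ => (hf j).empty
  mono S T h := Finset.sum_le_sum fun j _ => (hf j).mono S T h
  submod S T := by
    rw [← Finset.sum_add_distrib, ← Finset.sum_add_distrib]
    exact Finset.sum_le_sum fun j _ => (hf j).submod S T

/-- Submodularity for two sets of which the second contains the new element `e`, where each set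
consists of a part inside and a part outside of `T`. -/
theorem IsPolymatroidRank.uncross {f : Finset N → ℝ} (hf : IsPolymatroidRank f)
    {T A A' S S' : Finset N} {e : N} (hA : A ⊆ T) (hA' : A' ⊆ T) (hS : Disjoint S T)
    (hS' : Disjoint S' T) (he : e ∉ T) (heS : e ∉ S) :
    f ((A ∪ A') ∪ insert e (S ∪ S')) + f ((A ∩ A') ∪ (S ∩ S')) ≤
      f (A ∪ S) + f (insert e (A' ∪ S')) := by
  have h := hf.submod (A ∪ S) (insert e (A' ∪ S'))
  rw [Finset.disjoint_left] at hS hS'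
  have u : A ∪ S ∪ insert e (A' ∪ S') = (A ∪ A') ∪ insert e (S ∪ S') := by
    ext; simp only [Finset.mem_union, Finset.mem_insert]; tauto
  have i : (A ∪ S) ∩ insert e (A' ∪ S') = (A ∩ A') ∪ (S ∩ S') := by
    ext k
    have := @hA k
    have := @hA' k
    have := @hS k
    have := @hS' k
    have : k = e → k ∉ T ∧ k ∉ S := by rintro rfl; exact ⟨he, heS⟩
    simp only [Finset.mem_inter, Finset.mem_union, Finset.mem_insert]
    tauto
  rwa [u, i] at h

theorem exists_separating_of_forall_le {ι : Type} (I : Finset ι) (hI : I.Nonempty) {lo hi : ι → ℝ}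
    (h : ∀ i ∈ I, ∀ j ∈ I, lo i ≤ hi j) : ∃ α, ∀ i ∈ I, lo i ≤ α ∧ α ≤ hi i :=
  ⟨I.sup' hI lo, fun i hi =>
    ⟨Finset.le_sup' lo hi, Finset.sup'_le hI lo fun k hk => h k hk i hi⟩⟩

/-- The inductive step of the decomposition theorem for two polymatroids: the coordinates in `T`
have been split into a part `x` for the first and a part `y` for the second polymatroid. Each of
the remaining coordinates is still demanded as a whole from the sum of the two polymatroids. -/
theorem exists_partial_split [Fintype N] {f g : Finset N → ℝ} (hf : IsPolymatroidRank f)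
    (hg : IsPolymatroidRank g) {b : N → ℝ} (hb : b ∈ polymatroid fun S => f S + g S)
    (T : Finset N) : ∃ x y : N → ℝ, (∀ k ∈ T, 0 ≤ x k ∧ 0 ≤ y k ∧ x k + y k = b k) ∧
      ∀ A B S, A ⊆ T → B ⊆ T → Disjoint S T →
        ∑ k ∈ A, x k + ∑ k ∈ B, y k + ∑ k ∈ S, b k ≤ f (A ∪ S) + g (B ∪ S) := by
  induction T using Finset.induction_on with
  | empty =>
    refine ⟨0, 0, by simp, fun A B S hA hB _ => ?_⟩
    rw [Finset.subset_empty] at hA hB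
    subst hA hB
    simpa using hb.2 S
  | insert e T he ih =>
    obtain ⟨x, y, hxy, H⟩ := ih
    let I : Finset (Finset N × Finset N × Finset N) :=
      T.powerset ×ˢ T.powerset ×ˢ ((insert e T)ᶜ).powerset
    have memI : ∀ q : Finset N × Finset N × Finset N, q ∈ I ↔
        q.1 ⊆ T ∧ q.2.1 ⊆ T ∧ Disjoint q.2.2 (insert e T) := by
      intro q
      simp only [I, Finset.mem_product, Finset.mem_powerset,
        Finset.subset_compl_iff_disjoint_right]
    let val : Finset N × Finset N × Finset N → ℝ := fun q =>
      ∑ k ∈ q.1, x k + ∑ k ∈ q.2.1, y k + ∑ k ∈ q.2.2, b k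
    have key : ∀ p ∈ I, ∀ q ∈ I,
        max 0 (val p + b e - f (p.1 ∪ p.2.2) - g (insert e (p.2.1 ∪ p.2.2))) ≤
        min (b e) (f (insert e (q.1 ∪ q.2.2)) + g (q.2.1 ∪ q.2.2) - val q) := by
      rintro ⟨A', B', S'⟩ hp ⟨A, B, S⟩ hq
      obtain ⟨hA', hB', hS'⟩ := (memI _).1 hp
      obtain ⟨hA, hB, hS⟩ := (memI _).1 hq
      simp only [val] at hA' hB' hS' hA hB hS ⊢
      rw [Finset.disjoint_insert_right] at hS hS'
      have h1 := H A' B' S' hA' hB' hS'.2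
      have h2 := H A B S hA hB hS.2
      have h3 := hg.mono _ _ (Finset.subset_insert e (B' ∪ S'))
      have h4 := hf.mono _ _ (Finset.subset_insert e (A ∪ S))
      refine max_le (le_min (hb.1 e) (by linarith)) (le_min (by linarith) ?_)
      have h5 := H (A' ∪ A) (B' ∪ B) (insert e (S' ∪ S)) (Finset.union_subset hA' hA)
        (Finset.union_subset hB' hB)
        (Finset.disjoint_insert_left.2 ⟨he, Finset.disjoint_union_left.2 ⟨hS'.2, hS.2⟩⟩)
      have h6 := H (A' ∩ A) (B' ∩ B) (S' ∩ S) (Finset.inter_subset_left.trans hA')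
        (Finset.inter_subset_left.trans hB') (hS'.2.mono_left Finset.inter_subset_left)
      have h7 := hf.uncross hA' hA hS'.2 hS.2 he hS'.1
      have h8 := hg.uncross hB hB' hS.2 hS'.2 he hS.1
      rw [Finset.union_comm B, Finset.union_comm S, Finset.inter_comm B, Finset.inter_comm S] at h8
      rw [Finset.sum_insert (by simp [hS.1, hS'.1])] at h5
      have s1 := Finset.sum_union_inter (s₁ := A') (s₂ := A) (f := x)
      have s2 := Finset.sum_union_inter (s₁ := B') (s₂ := B) (f := y)
      have s3 := Finset.sum_union_inter (s₁ := S') (s₂ := S) (f := b)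
      linarith
    obtain ⟨α, hα⟩ := exists_separating_of_forall_le I
      ⟨(∅, ∅, ∅), (memI _).2 ⟨by simp, by simp, by simp⟩⟩ key
    have h0 := hα (∅, ∅, ∅) ((memI _).2 ⟨by simp, by simp, by simp⟩)
    refine ⟨Function.update x e α, Function.update y e (b e - α), ?_, ?_⟩
    · intro k hk
      by_cases hke : k = e
      · subst hke
        simp only [Function.update_self]
        exact ⟨(le_max_left _ _).trans h0.1, by linarith [h0.2.trans (min_le_left _ _)], by ring⟩
      · simpa [hke] using hxy k ((Finset.mem_insert.1 hk).resolve_left hke)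
    · intro A B S hA hB hS
      have sx : ∀ C : Finset N, C ⊆ T → ∑ k ∈ C, Function.update x e α k = ∑ k ∈ C, x k :=
        fun C hC => Finset.sum_congr rfl fun k hk =>
          Function.update_of_ne (fun h : k = e => he (h ▸ hC hk)) _ _
      have sy : ∀ C : Finset N, C ⊆ T →
          ∑ k ∈ C, Function.update y e (b e - α) k = ∑ k ∈ C, y k :=
        fun C hC => Finset.sum_congr rfl fun k hk =>
          Function.update_of_ne (fun h : k = e => he (h ▸ hC hk)) _ _
      have er : ∀ C : Finset N, C ⊆ insert e T → C.erase e ⊆ T := fun C hC => by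
        rwa [← Finset.subset_insert_iff]
      have hS' := Finset.disjoint_insert_right.1 hS
      by_cases hAe : e ∈ A <;> by_cases hBe : e ∈ B
      · have := H _ _ (insert e S) (er A hA) (er B hB)
          (Finset.disjoint_insert_left.2 ⟨he, hS'.2⟩)
        rw [Finset.sum_insert hS'.1] at this
        rw [← Finset.add_sum_erase A _ hAe, ← Finset.add_sum_erase B _ hBe, sx _ (er A hA),
          sy _ (er B hB), Function.update_self, Function.update_self]
        have u1 : A.erase e ∪ insert e S = A ∪ S := by
          ext k; by_cases hk : k = e
          · subst hk; simp [hAe]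
          · simp [hk]
        have u2 : B.erase e ∪ insert e S = B ∪ S := by
          ext k; by_cases hk : k = e
          · subst hk; simp [hBe]
          · simp [hk]
        rw [u1, u2] at this
        linarith
      · have hB' : B ⊆ T := by simpa [hBe] using er B hB
        have := (hα (A.erase e, B, S) ((memI _).2 ⟨er A hA, hB', hS⟩)).2.trans (min_le_right _ _)
        rw [← Finset.add_sum_erase A _ hAe, sx _ (er A hA), sy _ hB', Function.update_self]
        rw [← Finset.insert_union, Finset.insert_erase hAe] at this
        simp only [val] at this
        linarith
      · have hA' : A ⊆ T := by simpa [hAe] using er A hA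
        have := (le_max_right _ _).trans
          (hα (A, B.erase e, S) ((memI _).2 ⟨hA', er B hB, hS⟩)).1
        rw [← Finset.add_sum_erase B _ hBe, sx _ hA', sy _ (er B hB), Function.update_self]
        rw [← Finset.insert_union, Finset.insert_erase hBe] at this
        simp only [val] at this
        linarith
      · have hA' : A ⊆ T := by simpa [hAe] using er A hA
        have hB' : B ⊆ T := by simpa [hBe] using er B hB
        rw [sx _ hA', sy _ hB']
        exact H A B S hA' hB' hS'.2

theorem exists_add_of_mem_polymatroid_add [Fintype N] {f g : Finset N → ℝ}
    (hf : IsPolymatroidRank f) (hg : IsPolymatroidRank g) {b : N → ℝ}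
    (hb : b ∈ polymatroid fun S => f S + g S) :
    ∃ x ∈ polymatroid f, ∃ y ∈ polymatroid g, ∀ k, x k + y k = b k := by
  obtain ⟨x, y, hxy, H⟩ := exists_partial_split hf hg hb Finset.univ
  refine ⟨x, ⟨fun k => (hxy k (Finset.mem_univ k)).1, fun S => ?_⟩, y,
    ⟨fun k => (hxy k (Finset.mem_univ k)).2.1, fun S => ?_⟩,
    fun k => (hxy k (Finset.mem_univ k)).2.2⟩
  · simpa [hg.empty] using H S ∅ ∅ (Finset.subset_univ S) (by simp) (by simp)
  · simpa [hf.empty] using H ∅ S ∅ (by simp) (Finset.subset_univ S) (by simp)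

/-- A vector of the polymatroid of a sum of rank functions is a sum of vectors of the
summands. -/
theorem exists_sum_of_mem_polymatroid_sum [Fintype N] {M : Type} [DecidableEq M]
    {f : M → Finset N → ℝ} (hf : ∀ j, IsPolymatroidRank (f j)) (J : Finset M) {b : N → ℝ}
    (hb : b ∈ polymatroid fun S => ∑ j ∈ J, f j S) :
    ∃ x : M → N → ℝ, (∀ j ∈ J, x j ∈ polymatroid (f j)) ∧ ∀ k, ∑ j ∈ J, x j k = b k := by
  induction J using Finset.induction_on generalizing b with
  | empty =>
    refine ⟨0, by simp, fun k => ?_⟩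
    have h1 := hb.1 k
    have h2 := hb.2 {k}
    simp at h2
    simp
    linarith
  | insert e J he ih =>
    simp only [Finset.sum_insert he] at hb
    obtain ⟨y, hy, z, hz, hyz⟩ :=
      exists_add_of_mem_polymatroid_add (hf e) (IsPolymatroidRank.sum J hf) hb
    obtain ⟨x, hx, hxs⟩ := ih hz
    refine ⟨Function.update x e y, fun j hj => ?_, fun k => ?_⟩
    · by_cases hje : j = e
      · subst hje; simpa using hy
      · simpa [hje] using hx j ((Finset.mem_insert.1 hj).resolve_left hje)
    · rw [Finset.sum_insert he, Function.update_self, ← hyz k, ← hxs k]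
      congr 1
      exact Finset.sum_congr rfl fun j hj => by
        rw [Function.update_of_ne (fun h : j = e => he (h ▸ hj))]

omit [DecidableEq N] in
theorem isCompact_cappedPolymatroid (h : Finset N → ℝ) (d : N → ℝ≥0∞) :
    IsCompact (cappedPolymatroid h d) := by
  refine (isCompact_Icc (a := (0 : N → ℝ)) (b := fun k => h {k})).of_isClosed_subset ?_ ?_
  · simp only [cappedPolymatroid, polymatroid, Set.ofPred_and, Set.ofPred_forall]
    refine ((isClosed_iInter fun k => ?_).inter (isClosed_iInter fun S => ?_)).inter
      (isClosed_iInter fun k => ?_)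
    · exact isClosed_le continuous_const (continuous_apply k)
    · exact isClosed_le (by fun_prop) continuous_const
    · exact isClosed_le (ENNReal.continuous_ofReal.comp (continuous_apply k)) continuous_const
  · exact fun u hu => ⟨fun k => hu.1.1 k, fun k => by simpa using hu.1.2 {k}⟩

theorem tight_union {h : Finset N → ℝ} (hh : IsPolymatroidRank h) {u : N → ℝ}
    (hu : u ∈ polymatroid h) {S T : Finset N} (hS : ∑ k ∈ S, u k = h S)
    (hT : ∑ k ∈ T, u k = h T) : ∑ k ∈ S ∪ T, u k = h (S ∪ T) := by
  have := Finset.sum_union_inter (s₁ := S) (s₂ := T) (f := u)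
  linarith [hh.submod S T, hu.2 (S ∪ T), hu.2 (S ∩ T)]

/-- Every vector of a capped polymatroid lies below one that is saturated: outside of its largest
tight set `S`, all its coordinates are at capacity. -/
theorem exists_saturated [Fintype N] {h : Finset N → ℝ} (hh : IsPolymatroidRank h)
    {d : N → ℝ≥0∞} {u₀ : N → ℝ} (hu₀ : u₀ ∈ cappedPolymatroid h d) :
    ∃ u ∈ cappedPolymatroid h d, (∀ k, u₀ k ≤ u k) ∧ ∃ S, ∑ k ∈ S, u k = h S ∧
      (∀ k ∉ S, ENNReal.ofReal (u k) = d k) ∧ ∀ S', ∑ k ∈ S', u k = h S' → S' ⊆ S := by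
  obtain ⟨u, ⟨hu, hle⟩, hmax⟩ := ((isCompact_cappedPolymatroid h d).inter_right
    (isClosed_Ici (a := u₀))).exists_isMaxOn ⟨u₀, hu₀, le_refl u₀⟩
    (f := fun u : N → ℝ => ∑ k, u k) (by fun_prop)
  classical
  refine ⟨u, hu, fun k => hle k, (Finset.univ.filter fun S => ∑ k ∈ S, u k = h S).sup id,
    ?_, ?_, ?_⟩
  · refine Finset.sup_induction (p := fun S => ∑ k ∈ S, u k = h S) (by simp [hh.empty]) ?_ ?_
    · exact fun S hS T hT => tight_union hh hu.1 hS hT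
    · exact fun S hS => (Finset.mem_filter.1 hS).2
  · intro k hk
    by_contra hne
    have hlt : ENNReal.ofReal (u k) < d k := lt_of_le_of_ne (hu.2 k) hne
    have hslack : ∀ S : Finset N, k ∈ S → ∑ i ∈ S, u i < h S := fun S hS =>
      lt_of_le_of_ne (hu.1.2 S) fun h => hk
        (Finset.le_sup (f := id) (Finset.mem_filter.2 ⟨Finset.mem_univ S, h⟩) hS)
    have e1 : ∀ᶠ δ in nhdsWithin (0 : ℝ) (Set.Ioi 0), ENNReal.ofReal (u k + δ) < d k := by
      have : Filter.Tendsto (fun δ : ℝ => ENNReal.ofReal (u k + δ)) (nhds 0)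
          (nhds (ENNReal.ofReal (u k + 0))) :=
        (ENNReal.continuous_ofReal.comp (continuous_const.add continuous_id)).tendsto 0
      rw [add_zero] at this
      exact (this.eventually_lt_const hlt).filter_mono nhdsWithin_le_nhds
    have e2 : ∀ᶠ δ in nhdsWithin (0 : ℝ) (Set.Ioi 0),
        ∀ S : Finset N, k ∈ S → δ < h S - ∑ i ∈ S, u i := by
      refine Filter.eventually_all.2 fun S => ?_
      by_cases hS : k ∈ S
      · exact ((eventually_lt_nhds (sub_pos.2 (hslack S hS))).filter_mono
          nhdsWithin_le_nhds).mono fun δ hδ _ => hδ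
      · exact Filter.Eventually.of_forall fun δ h => absurd h hS
    obtain ⟨δ, hδ1, hδ2, hδ⟩ := (e1.and (e2.and self_mem_nhdsWithin)).exists
    have hδ : 0 < δ := hδ
    have hsum : ∀ S : Finset N, ∑ i ∈ S, Function.update u k (u k + δ) i =
        ∑ i ∈ S, u i + if k ∈ S then δ else 0 := by
      intro S
      by_cases hS : k ∈ S
      · rw [Finset.sum_update_of_mem hS, ← Finset.add_sum_erase S u hS, if_pos hS,
          Finset.sdiff_singleton_eq_erase]
        ring
      · rw [Finset.sum_update_of_notMem hS, if_neg hS, add_zero]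
    have hge : ∀ i, u i ≤ Function.update u k (u k + δ) i := by
      intro i
      by_cases hi : i = k
      · subst hi; simp [hδ.le]
      · simp [hi]
    have hmem : Function.update u k (u k + δ) ∈ cappedPolymatroid h d := by
      refine ⟨⟨fun i => (hu.1.1 i).trans (hge i), fun S => ?_⟩, fun i => ?_⟩
      · rw [hsum]
        split_ifs with hS
        · linarith [hδ2 S hS]
        · simpa using hu.1.2 S
      · by_cases hi : i = k
        · subst hi; simpa using hδ1.le
        · simpa [hi] using hu.2 i
    have := hmax ⟨hmem, fun i => (hle i).trans (hge i)⟩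
    have := hsum Finset.univ
    simp at *
    linarith
  · exact fun S' hS' => Finset.le_sup (f := id) (Finset.mem_filter.2 ⟨Finset.mem_univ S', hS'⟩)

end Polymatroid

/-! ### Residual supply -/

namespace Market

section Residual

variable {N M : Type} [Fintype N] [Fintype M] [DecidableEq N] (G : Market N M)

/-- The rank function of the polymatroid of all vectors that can be added to the transactions `w`
of seller `j`: the value at `S` is the minimum of `f_j(T) - w(T)` over all `T` between
`S ∩ E_j` and `E_j`. It is defined on all sets of buyers, not just on subsets of `E_j`. -/
noncomputable def residualRank (w : N → M → ℝ) (j : M) (S : Finset N) : ℝ :=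
  ((G.nbr j).powerset.filter (S ∩ G.nbr j ⊆ ·)).inf'
    ⟨G.nbr j, by simp [Finset.inter_subset_right]⟩ fun T => G.f j T - ∑ i ∈ T, w i j

/-- The total amount of goods that a set of buyers can get in addition to the transactions `w`,
if demands are ignored. -/
noncomputable def supply (w : N → M → ℝ) (S : Finset N) : ℝ := ∑ j, G.residualRank w j S

variable {G} {w : N → M → ℝ} {d : N → ℝ≥0∞} {i : N} {j : M} {ξ : M → ℝ}

omit [Fintype N] [Fintype M] in
theorem residualRank_le {S T : Finset N} (hST : S ∩ G.nbr j ⊆ T) (hT : T ⊆ G.nbr j) :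
    G.residualRank w j S ≤ G.f j T - ∑ i ∈ T, w i j :=
  Finset.inf'_le _ (by simp [hST, hT])

omit [Fintype N] [Fintype M] in
theorem exists_residualRank_eq (G : Market N M) (w : N → M → ℝ) (j : M) (S : Finset N) :
    ∃ T, S ∩ G.nbr j ⊆ T ∧ T ⊆ G.nbr j ∧
      G.residualRank w j S = G.f j T - ∑ i ∈ T, w i j := by
  obtain ⟨T, hT, h⟩ := Finset.exists_mem_eq_inf'
    (s := (G.nbr j).powerset.filter (S ∩ G.nbr j ⊆ ·))
    ⟨G.nbr j, by simp [Finset.inter_subset_right]⟩ fun T => G.f j T - ∑ i ∈ T, w i j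
  simp only [Finset.mem_filter, Finset.mem_powerset] at hT
  exact ⟨T, hT.2, hT.1, h⟩

omit [Fintype N] [Fintype M] in
theorem residualRank_mono {S T : Finset N} (h : S ⊆ T) :
    G.residualRank w j S ≤ G.residualRank w j T := by
  obtain ⟨U, h1, h2, h3⟩ := exists_residualRank_eq G w j T
  rw [h3]
  exact residualRank_le ((Finset.inter_subset_inter_right h).trans h1) h2

omit [Fintype N] [Fintype M] in
theorem isPolymatroidRank_residualRank (hw : w ∈ G.polytope) (j : M) :
    IsPolymatroidRank (G.residualRank w j) where
  empty := by
    refine le_antisymm ?_ ?_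
    · simpa [G.f_empty] using residualRank_le (G := G) (w := w) (j := j) (S := ∅) (T := ∅)
        (by simp) (by simp)
    · obtain ⟨T, _, h2, h3⟩ := exists_residualRank_eq G w j ∅
      rw [h3]
      linarith [hw.2.2 j T h2]
  mono _ _ h := residualRank_mono h
  submod S T := by
    obtain ⟨U, h1, h2, h3⟩ := exists_residualRank_eq G w j S
    obtain ⟨V, k1, k2, k3⟩ := exists_residualRank_eq G w j T
    have a := residualRank_le (G := G) (w := w) (j := j) (S := S ∪ T) (T := U ∪ V)
      (by rw [Finset.union_inter_distrib_right]; exact Finset.union_subset_union h1 k1)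
      (Finset.union_subset h2 k2)
    have b := residualRank_le (G := G) (w := w) (j := j) (S := S ∩ T) (T := U ∩ V)
      (by rw [Finset.inter_inter_distrib_right]; exact Finset.inter_subset_inter h1 k1)
      (Finset.inter_subset_left.trans h2)
    have c := Finset.sum_union_inter (s₁ := U) (s₂ := V) (f := fun i => w i j)
    linarith [G.f_submod j U V h2 k2]

omit [Fintype N] in
theorem isPolymatroidRank_supply (hw : w ∈ G.polytope) : IsPolymatroidRank (G.supply w) :=
  IsPolymatroidRank.sum Finset.univ (isPolymatroidRank_residualRank hw)

omit [Fintype M] in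
theorem sum_nbr_eq (hw : ∀ i j, i ∉ G.nbr j → w i j = 0) (j : M) :
    ∑ i ∈ G.nbr j, w i j = ∑ i, w i j :=
  Finset.sum_subset (Finset.subset_univ _) fun i _ hi => hw i j hi

theorem supply_univ (hw : w ∈ G.polytope) :
    G.supply w Finset.univ = ∑ j, (G.f j (G.nbr j) - ∑ i, w i j) := by
  refine Finset.sum_congr rfl fun j _ => ?_
  obtain ⟨T, h1, h2, h3⟩ := exists_residualRank_eq G w j Finset.univ
  rw [Finset.univ_inter] at h1
  rw [h3, h2.antisymm h1, sum_nbr_eq hw.2.1]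

omit [Fintype N] [Fintype M] in
theorem mem_polymatroid_residualRank_iff {y : N → ℝ} :
    y ∈ polymatroid (G.residualRank w j) ↔ (∀ i, 0 ≤ y i) ∧
      ∀ S T : Finset N, S ∩ G.nbr j ⊆ T → T ⊆ G.nbr j →
        ∑ i ∈ S, y i ≤ G.f j T - ∑ i ∈ T, w i j := by
  refine and_congr_right fun _ => ⟨fun h S T hS hT => (h S).trans (residualRank_le hS hT),
    fun h S => ?_⟩
  obtain ⟨T, h1, h2, h3⟩ := exists_residualRank_eq G w j S
  exact h3 ▸ h S T h1 h2

/-- The amounts of goods that the buyers can get are described by the residual supply. This is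
the decomposition theorem for polymatroids, applied to the residual polymatroids of the
sellers. -/
theorem mem_cappedPolymatroid_supply_iff (hw : w ∈ G.polytope) {u : N → ℝ} :
    u ∈ cappedPolymatroid (G.supply w) d ↔ ∃ y ∈ G.remnant w d, ∀ k, ∑ j, y k j = u k := by
  classical
  constructor
  · rintro ⟨hu, hd⟩
    obtain ⟨x, hx, hxu⟩ := exists_sum_of_mem_polymatroid_sum
      (isPolymatroidRank_residualRank hw) Finset.univ hu
    have hx' := fun j => mem_polymatroid_residualRank_iff.1 (hx j (Finset.mem_univ j))
    have h0 : ∀ i j, i ∉ G.nbr j → x j i = 0 := fun i j hij =>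
      le_antisymm (by simpa [G.f_empty] using (hx' j).2 {i} ∅ (by simp [hij]) (by simp))
        ((hx' j).1 i)
    refine ⟨fun k j => x j k, ⟨fun i j => (hx' j).1 i, h0, ⟨fun i j => ?_, fun i j hij => ?_,
      fun j F hF => ?_⟩, fun k => (hxu k).symm ▸ hd k⟩, hxu⟩
    · exact add_nonneg (hw.1 i j) ((hx' j).1 i)
    · simp [hw.2.1 i j hij, h0 i j hij]
    · have := (hx' j).2 F F Finset.inter_subset_left hF
      simp only [Pi.add_apply, Finset.sum_add_distrib]
      linarith
  · rintro ⟨y, ⟨h0, hE, hwy, hd⟩, hu⟩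
    refine ⟨⟨fun k => hu k ▸ Finset.sum_nonneg fun j _ => h0 k j, fun S => ?_⟩,
      fun k => hu k ▸ hd k⟩
    rw [← Finset.sum_congr rfl fun k _ => hu k, Finset.sum_comm]
    refine Finset.sum_le_sum fun j _ => (mem_polymatroid_residualRank_iff.2
      ⟨fun i => h0 i j, fun S T hS hT => ?_⟩ : (fun k => y k j) ∈ _).2 S
    have h1 : ∑ i ∈ S, y i j = ∑ i ∈ S ∩ G.nbr j, y i j :=
      (Finset.sum_subset Finset.inter_subset_left fun i hi hi' =>
        hE i j fun h => hi' (Finset.mem_inter.2 ⟨hi, h⟩)).symm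
    have h2 : ∑ i ∈ S ∩ G.nbr j, y i j ≤ ∑ i ∈ T, y i j :=
      Finset.sum_le_sum_of_subset_of_nonneg hS fun i _ _ => h0 i j
    have h3 := hwy.2.2 j T hT
    simp only [Pi.add_apply, Finset.sum_add_distrib] at h3
    linarith

omit [Fintype N] [Fintype M] in
theorem sum_update_add (w : N → M → ℝ) (i : N) (ξ : M → ℝ) (j : M) (T : Finset N) :
    ∑ k ∈ T, Function.update w i (w i + ξ) k j =
      ∑ k ∈ T, w k j + if i ∈ T then ξ j else 0 := by
  have h : ∀ k, Function.update w i (w i + ξ) k j = w k j + if k = i then ξ j else 0 := by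
    intro k
    by_cases hk : k = i
    · subst hk; simp
    · simp [hk]
  simp only [h, Finset.sum_add_distrib, Finset.sum_ite_eq']

omit [Fintype N] [Fintype M] in
theorem residualRank_update_of_mem (hξ : i ∉ G.nbr j → ξ j = 0) {S : Finset N} (hi : i ∈ S) :
    G.residualRank (Function.update w i (w i + ξ)) j S = G.residualRank w j S - ξ j := by
  have key : ∀ T : Finset N, S ∩ G.nbr j ⊆ T → (if i ∈ T then ξ j else 0) = ξ j := by
    intro T hT
    by_cases h : i ∈ G.nbr j
    · rw [if_pos (hT (Finset.mem_inter.2 ⟨hi, h⟩))]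
    · simp [hξ h]
  refine le_antisymm ?_ ?_
  · obtain ⟨T, h1, h2, h3⟩ := exists_residualRank_eq G w j S
    refine (residualRank_le h1 h2).trans_eq ?_
    rw [sum_update_add, key T h1, h3]
    ring
  · obtain ⟨T, h1, h2, h3⟩ := exists_residualRank_eq G (Function.update w i (w i + ξ)) j S
    rw [h3, sum_update_add, key T h1]
    linarith [residualRank_le (w := w) h1 h2]

omit [Fintype N] [Fintype M] in
theorem min_le_residualRank_update (hξ : i ∉ G.nbr j → ξ j = 0) (S : Finset N) :
    min (G.residualRank w j S) (G.residualRank w j (insert i S) - ξ j) ≤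
      G.residualRank (Function.update w i (w i + ξ)) j S := by
  obtain ⟨T, h1, h2, h3⟩ := exists_residualRank_eq G (Function.update w i (w i + ξ)) j S
  rw [h3, sum_update_add]
  split_ifs with hi
  · refine (min_le_right _ _).trans ?_
    have : insert i S ∩ G.nbr j ⊆ T := by
      intro k hk
      obtain ⟨hk1, hk2⟩ := Finset.mem_inter.1 hk
      rcases Finset.mem_insert.1 hk1 with rfl | hk1
      · exact hi
      · exact h1 (Finset.mem_inter.2 ⟨hk1, hk2⟩)
    linarith [residualRank_le (w := w) this h2]
  · refine (min_le_left _ _).trans ?_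
    linarith [residualRank_le (w := w) h1 h2]

omit [Fintype N] [Fintype M] in
theorem update_mem_polytope (hw : w ∈ G.polytope) (h0 : ∀ j, 0 ≤ ξ j)
    (hE : ∀ j, i ∉ G.nbr j → ξ j = 0) (hle : ∀ j, ξ j ≤ G.residualRank w j {i}) :
    Function.update w i (w i + ξ) ∈ G.polytope := by
  refine ⟨fun k j => ?_, fun k j hkj => ?_, fun j F hF => ?_⟩
  · by_cases hk : k = i
    · subst hk; simpa using add_nonneg (hw.1 k j) (h0 j)
    · simpa [hk] using hw.1 k j
  · by_cases hk : k = i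
    · subst hk; simp [hw.2.1 k j hkj, hE j hkj]
    · simpa [hk] using hw.2.1 k j hkj
  · rw [sum_update_add]
    split_ifs with hi
    · linarith [hle j, residualRank_le (G := G) (w := w) (S := {i}) (T := F)
        (Finset.inter_subset_left.trans (by simpa using hi)) hF]
    · simpa using hw.2.2 j F hF

omit [Fintype N] in
theorem zero_mem_cappedPolymatroid_supply (hw : w ∈ G.polytope) :
    (0 : N → ℝ) ∈ cappedPolymatroid (G.supply w) d := by
  have hr := isPolymatroidRank_supply hw
  refine ⟨⟨fun _ => le_rfl, fun S => ?_⟩, fun k => by simp⟩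
  simpa [hr.empty] using hr.mono ∅ S (Finset.empty_subset S)

end Residual

/-! ### Clinching -/

section Clinching

variable {N M : Type} [Fintype N] [Fintype M] [DecidableEq N] {G : Market N M}
  {w : N → M → ℝ} {d : N → ℝ≥0∞} {i : N} {ξ : M → ℝ}

/-- The possible future trade amounts after buyer `i` has taken `ξ`, in terms of the residual
supply after this transaction. -/
theorem mem_future_iff (hw : Function.update w i (w i + ξ) ∈ G.polytope)
    (h0 : ∀ j, 0 ≤ ξ j) (hE : ∀ j, i ∉ G.nbr j → ξ j = 0)
    (hd : ENNReal.ofReal (∑ j, ξ j) ≤ d i) {u : N → ℝ} (hui : u i = 0) :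
    (fun k : {k : N // k ≠ i} => u k) ∈ G.future w d i ξ ↔
      u ∈ cappedPolymatroid (G.supply (Function.update w i (w i + ξ)))
        (Function.update d i 0) := by
  rw [mem_cappedPolymatroid_supply_iff hw]
  constructor
  · rintro ⟨y, ⟨y0, yE, hwy, hyd⟩, hyi, hyu⟩
    have hadd : Function.update w i (w i + ξ) + Function.update y i 0 = w + y := by
      ext k j
      by_cases hk : k = i
      · subst hk; simp [hyi]
      · simp [hk]
    refine ⟨Function.update y i 0, ⟨fun k j => ?_, fun k j hkj => ?_, hadd ▸ hwy, fun k => ?_⟩,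
      fun k => ?_⟩ <;> by_cases hk : k = i
    · subst hk; simp
    · simpa [hk] using y0 k j
    · subst hk; simp
    · simpa [hk] using yE k j hkj
    · subst hk; simp
    · simpa [hk] using hyd k
    · subst hk; simp [hui]
    · simpa [hk] using hyu ⟨k, hk⟩
  · rintro ⟨y, ⟨y0, yE, hwy, hyd⟩, hyu⟩
    have hyi : ∀ j, y i j = 0 := fun j =>
      (Finset.sum_eq_zero_iff_of_nonneg fun j _ => y0 i j).1 ((hyu i).trans hui) j
        (Finset.mem_univ j)
    have hadd : w + Function.update y i ξ = Function.update w i (w i + ξ) + y := by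
      ext k j
      by_cases hk : k = i
      · subst hk; simp [hyi]
      · simp [hk]
    refine ⟨Function.update y i ξ, ⟨fun k j => ?_, fun k j hkj => ?_, hadd ▸ hwy, fun k => ?_⟩,
      by simp, fun k => by simpa [k.2] using hyu k⟩ <;> by_cases hk : k = i
    · subst hk; simpa using h0 j
    · simpa [hk] using y0 k j
    · subst hk; simpa using hE j hkj
    · simpa [hk] using yE k j hkj
    · subst hk; simpa using hd
    · simpa [hk] using hyd k

omit [Fintype N] [Fintype M] in
theorem mem_polytope_of_le {y z : N → M → ℝ} (hz : z ∈ G.polytope) (h0 : ∀ i j, 0 ≤ y i j)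
    (hle : ∀ i j, y i j ≤ z i j) : y ∈ G.polytope :=
  ⟨h0, fun i j hij => le_antisymm ((hle i j).trans_eq (hz.2.1 i j hij)) (h0 i j),
    fun j F hF => (Finset.sum_le_sum fun i _ => hle i j).trans (hz.2.2 j F hF)⟩

/-- The clinching polytope in terms of the residual supply. -/
theorem mem_clinchPolytope_iff (hw : w ∈ G.polytope) :
    ξ ∈ G.clinchPolytope w d i ↔ (∀ j, 0 ≤ ξ j) ∧ (∀ j, i ∉ G.nbr j → ξ j = 0) ∧
      Function.update w i (w i + ξ) ∈ G.polytope ∧ ENNReal.ofReal (∑ j, ξ j) ≤ d i ∧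
      cappedPolymatroid (G.supply w) (Function.update d i 0) ⊆
        cappedPolymatroid (G.supply (Function.update w i (w i + ξ)))
          (Function.update d i 0) := by
  have hu0 : ∀ {h : Finset N → ℝ} {u : N → ℝ},
      u ∈ cappedPolymatroid h (Function.update d i 0) → u i = 0 := fun {h u} hu =>
    le_antisymm (by simpa using hu.2 i) (hu.1.1 i)
  have hself : Function.update w i (w i + 0) = w := by simp
  have hzero : ∀ u : N → ℝ, u i = 0 → ((fun k : {k : N // k ≠ i} => u k) ∈ G.future w d i 0 ↔
      u ∈ cappedPolymatroid (G.supply w) (Function.update d i 0)) := fun u hu => by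
    have := mem_future_iff (G := G) (w := w) (d := d) (i := i) (ξ := 0) (hself.symm ▸ hw)
      (by simp) (by simp) (by simp) hu
    rwa [hself] at this
  constructor
  · rintro ⟨h0, hE, hfut⟩
    have h : (fun k : {k : N // k ≠ i} => (0 : N → ℝ) k) ∈ G.future w d i ξ :=
      hfut ▸ (hzero 0 rfl).2 (zero_mem_cappedPolymatroid_supply hw)
    obtain ⟨y, ⟨y0, yE, hwy, hyd⟩, hyi, hyu⟩ := h
    have hP : Function.update w i (w i + ξ) ∈ G.polytope := by
      refine mem_polytope_of_le hwy (fun k j => ?_) fun k j => ?_ <;> by_cases hk : k = i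
      · subst hk; simpa using add_nonneg (hw.1 k j) (h0 j)
      · simpa [hk] using hw.1 k j
      · subst hk; simp [hyi]
      · simpa [hk] using y0 k j
    have hd : ENNReal.ofReal (∑ j, ξ j) ≤ d i := hyi ▸ hyd i
    refine ⟨h0, hE, hP, hd, fun u hu => ?_⟩
    rw [← mem_future_iff hP h0 hE hd (hu0 hu), hfut]
    exact (hzero u (hu0 hu)).2 hu
  · rintro ⟨h0, hE, hP, hd, hsub⟩
    refine ⟨h0, hE, Set.Subset.antisymm ?_ fun u hu => ?_⟩
    · rintro u ⟨y, ⟨y0, yE, hwy, hyd⟩, hyi, hyu⟩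
      refine ⟨Function.update y i 0, ⟨fun k j => ?_, fun k j hkj => ?_,
        mem_polytope_of_le hwy (fun k j => ?_) (fun k j => ?_), fun k => ?_⟩, by simp,
        fun k => by simpa [k.2] using hyu k⟩ <;> by_cases hk : k = i
      · subst hk; simp
      · simpa [hk] using y0 k j
      · subst hk; simp
      · simpa [hk] using yE k j hkj
      · subst hk; simpa using hw.1 k j
      · simpa [hk] using add_nonneg (hw.1 k j) (y0 k j)
      · subst hk; simpa using y0 k j
      · simp [hk]
      · subst hk; simp
      · simpa [hk] using hyd k
    · let ext : N → ℝ := fun k => if hk : k ≠ i then u ⟨k, hk⟩ else 0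
      have hext : (fun k : {k : N // k ≠ i} =>
          ext k) = u := by
        funext k; exact dif_pos k.2
      have hi : ext i = 0 := dif_neg (not_not.2 rfl)
      rw [← hext] at hu ⊢
      exact (mem_future_iff hP h0 hE hd hi).2 (hsub ((hzero ext hi).1 hu))

omit [Fintype N] in
theorem continuous_supply_update (w : N → M → ℝ) (i : N) (S : Finset N) :
    Continuous fun ξ : M → ℝ => G.supply (Function.update w i (w i + ξ)) S := by
  refine continuous_finsetSum _ fun j _ => ?_
  refine Continuous.finset_inf'_apply _ fun T _ => ?_
  simp only [sum_update_add]
  split_ifs <;> fun_prop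

omit [Fintype N] [Fintype M] in
theorem isClosed_polytope (G : Market N M) : IsClosed G.polytope := by
  have happ : ∀ (k : N) (j : M), Continuous fun y : N → M → ℝ => y k j := fun k j => by fun_prop
  simp only [polytope, Set.ofPred_and, Set.ofPred_forall]
  refine (isClosed_iInter fun k => isClosed_iInter fun j => ?_).inter ((isClosed_iInter fun k =>
    isClosed_iInter fun j => isClosed_iInter fun _ => ?_).inter (isClosed_iInter fun j =>
    isClosed_iInter fun F => isClosed_iInter fun _ => ?_))
  · exact isClosed_le continuous_const (happ k j)
  · exact isClosed_eq (happ k j) continuous_const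
  · exact isClosed_le (continuous_finsetSum _ fun k _ => happ k j) continuous_const

omit [Fintype N] [Fintype M] in
theorem le_of_mem_polytope {y : N → M → ℝ} (hy : y ∈ G.polytope) (i : N) (j : M) :
    y i j ≤ G.f j (G.nbr j) := by
  by_cases h : i ∈ G.nbr j
  · exact (Finset.single_le_sum (f := fun i => y i j) (fun k _ => hy.1 k j) h).trans
      (hy.2.2 j _ subset_rfl)
  · rw [hy.2.1 i j h, ← G.f_empty j]
    exact G.f_mono j _ _ (Finset.empty_subset _) subset_rfl

omit [Fintype N] [Fintype M] in
theorem isCompact_polytope (G : Market N M) : IsCompact G.polytope :=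
  (isCompact_Icc (a := (0 : N → M → ℝ)) (b := fun _ j => G.f j (G.nbr j))).of_isClosed_subset
    G.isClosed_polytope fun _ hy => ⟨fun i j => hy.1 i j, fun i j => le_of_mem_polytope hy i j⟩

theorem exists_maximal_clinch (hw : w ∈ G.polytope) (d : N → ℝ≥0∞) (i : N) :
    ∃ ξ, Maximal (fun η => η ∈ G.clinchPolytope w d i) ξ := by
  have hcl : IsClosed (G.clinchPolytope w d i) := by
    have : G.clinchPolytope w d i = {ξ | (∀ j, 0 ≤ ξ j) ∧ (∀ j, i ∉ G.nbr j → ξ j = 0) ∧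
        Function.update w i (w i + ξ) ∈ G.polytope ∧ ENNReal.ofReal (∑ j, ξ j) ≤ d i ∧
        ∀ u ∈ cappedPolymatroid (G.supply w) (Function.update d i 0), ∀ S : Finset N,
          ∑ k ∈ S, u k ≤ G.supply (Function.update w i (w i + ξ)) S} := by
      ext ξ
      rw [mem_clinchPolytope_iff hw]
      refine and_congr_right fun _ => and_congr_right fun _ => and_congr_right fun _ =>
        and_congr_right fun _ => ⟨fun h u hu S => (h hu).1.2 S, fun h u hu =>
          ⟨⟨hu.1.1, fun S => h u hu S⟩, hu.2⟩⟩
    rw [this]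
    simp only [Set.ofPred_and, Set.ofPred_forall]
    refine (isClosed_iInter fun j => ?_).inter ((isClosed_iInter fun j => isClosed_iInter fun _ =>
      ?_).inter (IsClosed.inter ?_ (IsClosed.inter ?_ (isClosed_iInter fun u => isClosed_iInter
        fun _ => isClosed_iInter fun S => ?_))))
    · exact isClosed_le continuous_const (by fun_prop)
    · exact isClosed_eq (by fun_prop) continuous_const
    · exact G.isClosed_polytope.preimage (by fun_prop)
    · exact isClosed_le (ENNReal.continuous_ofReal.comp (by fun_prop)) continuous_const
    · exact isClosed_le continuous_const (continuous_supply_update w i S)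
  have hcpt : IsCompact (G.clinchPolytope w d i) := by
    refine (isCompact_Icc (a := (0 : M → ℝ)) (b := fun j => G.f j (G.nbr j))).of_isClosed_subset
      hcl fun ξ hξ => ⟨hξ.1, fun j => ?_⟩
    have h := le_of_mem_polytope ((mem_clinchPolytope_iff hw).1 hξ).2.2.1 i j
    simp only [Function.update_self, Pi.add_apply] at h
    linarith [hw.1 i j]
  obtain ⟨ξ, hξ, hmax⟩ := hcpt.exists_isMaxOn ⟨0, by simp [clinchPolytope]⟩
    (f := fun ξ : M → ℝ => ∑ j, ξ j) (by fun_prop)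
  refine ⟨ξ, hξ, fun η hη hle => ?_⟩
  have hsum := (Finset.sum_eq_sum_iff_of_le fun j _ => hle j).1
    (le_antisymm (Finset.sum_le_sum fun j _ => hle j) (hmax hη))
  exact fun j => (hsum j (Finset.mem_univ j)).ge

/-- Capacities after buyer `i` has clinched `X` units. -/
noncomputable def capAfter (d : N → ℝ≥0∞) (i : N) (X : ℝ) : N → ℝ≥0∞ :=
  Function.update d i (d i - ENNReal.ofReal X)

omit [Fintype N] in
theorem supply_update_of_mem (hE : ∀ j, i ∉ G.nbr j → ξ j = 0) {S : Finset N} (hi : i ∈ S) :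
    G.supply (Function.update w i (w i + ξ)) S = G.supply w S - ∑ j, ξ j := by
  simp only [supply, ← Finset.sum_sub_distrib]
  exact Finset.sum_congr rfl fun j _ => residualRank_update_of_mem (hE j) hi

/-- `u` is a base: it distributes the whole remaining supply among the buyers, respecting the
capacities `d`. -/
def IsBase (G : Market N M) (w : N → M → ℝ) (d : N → ℝ≥0∞) (u : N → ℝ) : Prop :=
  u ∈ cappedPolymatroid (G.supply w) d ∧ ∑ k, u k = G.supply w Finset.univ

/-- A base stays a base when buyer `i` clinches and her share is reduced by what she has
clinched. In particular, no base gives her less than that. -/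
theorem IsBase.clinch (hw : w ∈ G.polytope) (hξ : ξ ∈ G.clinchPolytope w d i) {u : N → ℝ}
    (hu : G.IsBase w d u) :
    G.IsBase (Function.update w i (w i + ξ)) (capAfter d i (∑ j, ξ j))
      (Function.update u i (u i - ∑ j, ξ j)) := by
  obtain ⟨h0, hE, hP, hd, hsub⟩ := (mem_clinchPolytope_iff hw).1 hξ
  have hX : 0 ≤ ∑ j, ξ j := Finset.sum_nonneg fun j _ => h0 j
  obtain ⟨hu, hsum⟩ := hu
  have sum0 : ∀ (S : Finset N) (a : ℝ), ∑ k ∈ S, Function.update u i a k =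
      ∑ k ∈ S, u k + if i ∈ S then a - u i else 0 := by
    intro S a
    by_cases hS : i ∈ S
    · rw [Finset.sum_update_of_mem hS, ← Finset.add_sum_erase S u hS, if_pos hS,
        Finset.sdiff_singleton_eq_erase]
      ring
    · rw [Finset.sum_update_of_notMem hS, if_neg hS, add_zero]
  have hu0 := hsub (a := Function.update u i 0) ⟨⟨fun k => by
    by_cases hk : k = i
    · subst hk; simp
    · simpa [hk] using hu.1.1 k, fun S => by
      rw [sum0]
      have := hu.1.2 S
      have := hu.1.1 i
      split_ifs <;> linarith⟩, fun k => by
    by_cases hk : k = i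
    · subst hk; simp
    · simpa [hk] using hu.2 k⟩
  have hXu : ∑ j, ξ j ≤ u i := by
    have := hu0.1.2 Finset.univ
    rw [sum0, if_pos (Finset.mem_univ i), supply_update_of_mem hE (Finset.mem_univ i), hsum] at this
    linarith
  refine ⟨⟨⟨fun k => ?_, fun S => ?_⟩, fun k => ?_⟩, ?_⟩
  · by_cases hk : k = i
    · subst hk; simpa using hXu
    · simpa [hk] using hu.1.1 k
  · by_cases hS : i ∈ S
    · rw [sum0, if_pos hS, supply_update_of_mem hE hS]
      linarith [hu.1.2 S]
    · have := hu0.1.2 S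
      rw [sum0, if_neg hS] at this
      rwa [sum0, if_neg hS]
  · by_cases hk : k = i
    · subst hk
      simp only [Function.update_self, capAfter]
      rw [ENNReal.ofReal_sub _ hX]
      exact tsub_le_tsub_right (hu.2 k) _
    · simpa [hk, capAfter] using hu.2 k
  · rw [sum0, if_pos (Finset.mem_univ i), supply_update_of_mem hE (Finset.mem_univ i), hsum]
    ring

/-- If buyer `i` cannot clinch more from seller `j` although she has demand left, then some tight
set of buyers blocks her: it could use up everything that seller `j` has for it and `i`. -/
theorem exists_tight_of_maximal (hw : w ∈ G.polytope)
    (hξ : Maximal (fun η => η ∈ G.clinchPolytope w d i) ξ)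
    (hd : ENNReal.ofReal (∑ j, ξ j) < d i) (j : M) (hij : i ∈ G.nbr j) :
    ∃ u ∈ cappedPolymatroid (G.supply (Function.update w i (w i + ξ))) (Function.update d i 0),
      ∃ S, ∑ k ∈ S, u k = G.supply (Function.update w i (w i + ξ)) S ∧
        G.residualRank (Function.update w i (w i + ξ)) j (insert i S) =
          G.residualRank (Function.update w i (w i + ξ)) j S := by
  classical
  obtain ⟨h0, hE, hP, -, hsub⟩ := (mem_clinchPolytope_iff hw).1 hξ.1
  set w' := Function.update w i (w i + ξ) with hw'
  set D := cappedPolymatroid (G.supply w') (Function.update d i 0) with hD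
  by_contra! hcon
  have hrk := isPolymatroidRank_residualRank hP j
  have e1 : ∀ᶠ δ in nhdsWithin (0 : ℝ) (Set.Ioi 0), ENNReal.ofReal (∑ j, ξ j + δ) < d i := by
    have : Filter.Tendsto (fun δ : ℝ => ENNReal.ofReal (∑ j, ξ j + δ)) (nhds 0)
        (nhds (ENNReal.ofReal (∑ j, ξ j + 0))) :=
      (ENNReal.continuous_ofReal.comp (continuous_const.add continuous_id)).tendsto 0
    rw [add_zero] at this
    exact (this.eventually_lt_const hd).filter_mono nhdsWithin_le_nhds
  have e2 : ∀ᶠ δ in nhdsWithin (0 : ℝ) (Set.Ioi 0), ∀ S : Finset N,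
      G.residualRank w' j S < G.residualRank w' j (insert i S) →
        δ < G.residualRank w' j (insert i S) - G.residualRank w' j S := by
    refine Filter.eventually_all.2 fun S => ?_
    by_cases hS : G.residualRank w' j S < G.residualRank w' j (insert i S)
    · exact ((eventually_lt_nhds (sub_pos.2 hS)).filter_mono nhdsWithin_le_nhds).mono
        fun δ hδ _ => hδ
    · exact Filter.Eventually.of_forall fun δ h => absurd h hS
  have e3 : ∀ᶠ δ in nhdsWithin (0 : ℝ) (Set.Ioi 0), ∀ S : Finset N,
      G.residualRank w' j (insert i S) = G.residualRank w' j S →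
        ∀ u ∈ D, δ < G.supply w' S - ∑ k ∈ S, u k := by
    refine Filter.eventually_all.2 fun S => ?_
    by_cases hS : G.residualRank w' j (insert i S) = G.residualRank w' j S
    · obtain ⟨u, hu, hmax⟩ := (isCompact_cappedPolymatroid (G.supply w')
        (Function.update d i 0)).exists_isMaxOn ⟨0, zero_mem_cappedPolymatroid_supply hP⟩
        (f := fun u : N → ℝ => ∑ k ∈ S, u k) (by fun_prop)
      have hlt : ∑ k ∈ S, u k < G.supply w' S :=
        lt_of_le_of_ne (hu.1.2 S) fun h => hcon u hu S h hS
      refine ((eventually_lt_nhds (sub_pos.2 hlt)).filter_mono nhdsWithin_le_nhds).mono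
        fun δ hδ _ u' hu' => ?_
      have : ∑ k ∈ S, u' k ≤ ∑ k ∈ S, u k := hmax hu'
      linarith
    · exact Filter.Eventually.of_forall fun δ h => absurd h hS
  obtain ⟨δ, hδ1, hδ2, hδ3, hδ⟩ := (e1.and (e2.and (e3.and self_mem_nhdsWithin))).exists
  have hδ : 0 < δ := hδ
  have hwadd : Function.update w i (w i + (ξ + Pi.single j δ)) =
      Function.update w' i (w' i + Pi.single j δ) := by
    simp [hw', add_assoc]
  have hsE : ∀ j', i ∉ G.nbr j' → (Pi.single j δ : M → ℝ) j' = 0 := fun j' hj' =>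
    by simp [show j' ≠ j from fun h => hj' (h ▸ hij)]
  have hs0 : ∀ j', 0 ≤ (Pi.single j δ : M → ℝ) j' := fun j' => by
    by_cases h : j' = j
    · subst h; simpa using hδ.le
    · simp [h]
  have hnonneg : ∀ j', 0 ≤ G.residualRank w' j' {i} := fun j' => by
    have hr := isPolymatroidRank_residualRank hP j'
    simpa [hr.empty] using hr.mono ∅ {i} (by simp)
  have hP' : Function.update w' i (w' i + Pi.single j δ) ∈ G.polytope := by
    refine update_mem_polytope hP hs0 hsE fun j' => ?_
    by_cases h : j' = j
    · subst h
      -- Otherwise the empty set would block buyer `i`.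
      have hne : G.residualRank w' j' (insert i ∅) ≠ G.residualRank w' j' ∅ :=
        hcon 0 (zero_mem_cappedPolymatroid_supply hP) ∅
          (by simp [(isPolymatroidRank_supply hP).empty])
      have := hδ2 ∅ (lt_of_le_of_ne (hrk.mono _ _ (by simp)) hne.symm)
      simp only [hrk.empty, sub_zero, insert_empty_eq] at this
      simpa using this.le
    · simpa [h] using hnonneg j'
  have hmem : ξ + Pi.single j δ ∈ G.clinchPolytope w d i := by
    rw [mem_clinchPolytope_iff hw]
    refine ⟨fun j' => add_nonneg (h0 j') (hs0 j'), fun j' hj' => ?_, hwadd ▸ hP', ?_, ?_⟩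
    · rw [Pi.add_apply, hE j' hj', hsE j' hj', add_zero]
    · simpa [Finset.sum_add_distrib] using hδ1.le
    · rw [hwadd]
      intro u hu
      have hu := hsub hu
      have hui : u i = 0 := le_antisymm (by simpa using hu.2 i) (hu.1.1 i)
      refine ⟨⟨hu.1.1, fun S => ?_⟩, hu.2⟩
      have hsum : ∑ k ∈ S, u k = ∑ k ∈ S.erase i, u k := by
        by_cases hS : i ∈ S
        · rw [← Finset.add_sum_erase S u hS, hui, zero_add]
        · rw [Finset.erase_eq_of_notMem hS]
      rw [hsum]
      refine le_trans ?_ ((isPolymatroidRank_supply hP').mono _ _ (Finset.erase_subset i S))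
      set S' := S.erase i
      have hother : ∀ j' ∈ Finset.univ.erase j, G.residualRank w' j' S' ≤
          G.residualRank (Function.update w' i (w' i + Pi.single j δ)) j' S' := by
        intro j' hj'
        refine le_trans (le_min le_rfl ?_) (min_le_residualRank_update (hsE j') S')
        rw [Pi.single_eq_of_ne (Finset.ne_of_mem_erase hj'), sub_zero]
        exact residualRank_mono (Finset.subset_insert _ _)
      have hthis := min_le_residualRank_update (w := w') (hsE j) S'
      rw [Pi.single_eq_same] at hthis
      have h1 := Finset.sum_le_sum hother
      have h2 : G.supply w' S' = G.residualRank w' j S' +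
          ∑ j' ∈ Finset.univ.erase j, G.residualRank w' j' S' :=
        (Finset.add_sum_erase _ _ (Finset.mem_univ j)).symm
      have h3 : G.supply (Function.update w' i (w' i + Pi.single j δ)) S' = _ :=
        (Finset.add_sum_erase _ _ (Finset.mem_univ j)).symm
      have h4 := hu.1.2 S'
      rcases (hrk.mono _ _ (Finset.subset_insert i S')).lt_or_eq with hlt | heq
      · have := hδ2 S' hlt
        rw [min_eq_left (by linarith)] at hthis
        linarith
      · have := hδ3 S' heq.symm u hu
        rw [min_eq_right (by linarith)] at hthis
        linarith
  have := hξ.2 hmem (fun j' => le_add_of_nonneg_right (hs0 j')) j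
  simp at this
  linarith

/-- After buyer `i` has clinched a maximal vector, the others could buy the whole remaining
supply. -/
theorem exists_base_eq_zero_of_maximal (hw : w ∈ G.polytope)
    (hξ : Maximal (fun η => η ∈ G.clinchPolytope w d i) ξ) (hbase : ∃ u, G.IsBase w d u) :
    ∃ u, G.IsBase (Function.update w i (w i + ξ)) (capAfter d i (∑ j, ξ j)) u ∧ u i = 0 := by
  obtain ⟨y, hy⟩ := hbase
  have hy := hy.clinch hw hξ.1
  obtain ⟨h0, hE, hP, hd, hsub⟩ := (mem_clinchPolytope_iff hw).1 hξ.1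
  have hX : 0 ≤ ∑ j, ξ j := Finset.sum_nonneg fun j _ => h0 j
  set w' := Function.update w i (w i + ξ) with hw'
  set y' := Function.update y i (y i - ∑ j, ξ j)
  rcases hd.eq_or_lt with heq | hlt
  · refine ⟨y', hy, le_antisymm ?_ (hy.1.1.1 i)⟩
    have := hy.1.2 i
    simpa [capAfter, ← heq] using this
  have hr := isPolymatroidRank_supply hP
  obtain ⟨u, hu, -, S, hS, hcap, hmaxS⟩ := exists_saturated hr
    (zero_mem_cappedPolymatroid_supply (d := Function.update d i 0) hP)
  have hui : u i = 0 := le_antisymm (by simpa using hu.2 i) (hu.1.1 i)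
  have hle : ∀ (z : N → ℝ) (d' : N → ℝ≥0∞), (∀ k, ENNReal.ofReal (z k) ≤ d' k) →
      (∀ k, k ≠ i → d' k = d k) → ∀ k, k ∉ S → k ≠ i → z k ≤ u k := by
    intro z d' hz hd' k hk hki
    have h1 := hcap k hk
    rw [Function.update_of_ne hki] at h1
    exact (ENNReal.ofReal_le_ofReal_iff (hu.1.1 k)).1 (((hz k).trans_eq (hd' k hki)).trans_eq
      h1.symm)
  have hrank : ∀ j, G.residualRank w' j (insert i S) = G.residualRank w' j S := by
    intro j
    have hrj := isPolymatroidRank_residualRank hP j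
    by_cases hij : i ∈ G.nbr j
    · obtain ⟨z, hz, T, hT, hTj⟩ := exists_tight_of_maximal hw hξ hlt j hij
      rw [← hw'] at hz hT hTj
      -- The set `T`, tight for `z`, is contained in `S`, as `S ∪ T` is tight for `u`.
      have hTS : T ⊆ S := by
        have h1 : ∑ k ∈ T \ S, z k ≤ ∑ k ∈ T \ S, u k := by
          refine Finset.sum_le_sum fun k hk => ?_
          by_cases hki : k = i
          · subst hki
            rw [hui]
            simpa using hz.2 k
          · exact hle z _ hz.2 (fun k hk => Function.update_of_ne hk _ _) k
              (Finset.mem_sdiff.1 hk).2 hki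
        have h2 := Finset.sum_inter_add_sum_sdiff T S z
        have h3 := hz.1.2 (T ∩ S)
        have h4 := hr.submod S T
        have h5 : ∑ k ∈ S ∪ T, u k = ∑ k ∈ S, u k + ∑ k ∈ T \ S, u k := by
          rw [← Finset.sum_union Finset.disjoint_sdiff, Finset.union_sdiff_self_eq_union]
        rw [Finset.inter_comm T S] at h2 h3
        exact Finset.subset_union_right.trans
          (hmaxS (S ∪ T) (le_antisymm (hu.1.2 _) (by linarith)))
      have h1 := hrj.submod S (insert i T)
      have h2 : S ∪ insert i T = insert i S := by
        rw [Finset.union_insert, Finset.union_eq_left.2 hTS]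
      have h3 := hrj.mono T (S ∩ insert i T)
        (Finset.subset_inter hTS (Finset.subset_insert i T))
      rw [h2] at h1
      exact le_antisymm (by linarith) (hrj.mono _ _ (Finset.subset_insert i S))
    · simp only [residualRank, Finset.insert_inter_of_notMem hij]
  have hsupply : G.supply w' (insert i S) = G.supply w' S :=
    Finset.sum_congr rfl fun j _ => hrank j
  refine ⟨u, ⟨⟨hu.1, fun k => ?_⟩, le_antisymm (hu.1.2 _) ?_⟩, hui⟩
  · by_cases hki : k = i
    · subst hki; simp [hui]
    · simpa [hki, capAfter] using hu.2 k
  · have h1 : ∑ k ∈ Finset.univ \ insert i S, y' k ≤ ∑ k ∈ Finset.univ \ insert i S, u k := by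
      refine Finset.sum_le_sum fun k hk => ?_
      simp only [Finset.mem_sdiff, Finset.mem_univ, true_and, Finset.mem_insert, not_or] at hk
      exact hle y' _ hy.1.2 (fun k hk => Function.update_of_ne hk _ _) k hk.2 hk.1
    have h2 := Finset.sum_sdiff (Finset.subset_univ (insert i S)) (f := y')
    have h3 := Finset.sum_sdiff (Finset.subset_univ (insert i S)) (f := u)
    have h4 := hy.1.1.2 (insert i S)
    have h5 := hy.2
    have h6 : ∑ k ∈ insert i S, u k = ∑ k ∈ S, u k := by
      by_cases hi : i ∈ S
      · rw [Finset.insert_eq_of_mem hi]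
      · rw [Finset.sum_insert hi, hui, zero_add]
    linarith

/-- If the others could buy everything, then any base can be turned into one in which buyer `l`
gets nothing, without taking anything away from the others. -/
theorem IsBase.exists_drop (hw : w ∈ G.polytope) {u z : N → ℝ} {l : N} (hu : G.IsBase w d u)
    (hz : G.IsBase w d z) (hzl : z l = 0) :
    ∃ u', G.IsBase w d u' ∧ u' l = 0 ∧ ∀ k, k ≠ l → u k ≤ u' k := by
  have hr := isPolymatroidRank_supply hw
  have hle0 : ∀ k, Function.update u l 0 k ≤ u k := fun k => by
    by_cases hk : k = l
    · subst hk; simpa using hu.1.1.1 k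
    · simp [hk]
  have hu0 : Function.update u l 0 ∈ cappedPolymatroid (G.supply w) (Function.update d l 0) := by
    refine ⟨⟨fun k => ?_, fun S => (Finset.sum_le_sum fun k _ => hle0 k).trans (hu.1.1.2 S)⟩,
      fun k => ?_⟩ <;> by_cases hk : k = l
    · subst hk; simp
    · simpa [hk] using hu.1.1.1 k
    · subst hk; simp
    · simpa [hk] using hu.1.2 k
  obtain ⟨u', hu', hge, S, hS, hcap, -⟩ := exists_saturated hr hu0
  have hul : u' l = 0 := le_antisymm (by simpa using hu'.2 l) (hu'.1.1 l)
  refine ⟨u', ⟨⟨hu'.1, fun k => ?_⟩, le_antisymm (hu'.1.2 _) ?_⟩, hul, fun k hk => ?_⟩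
  · by_cases hk : k = l
    · subst hk; simp [hul]
    · simpa [hk] using hu'.2 k
  · have h1 : ∑ k ∈ Finset.univ \ S, z k ≤ ∑ k ∈ Finset.univ \ S, u' k := by
      refine Finset.sum_le_sum fun k hk => ?_
      by_cases hkl : k = l
      · subst hkl; rw [hzl, hul]
      · have h2 := hcap k (Finset.mem_sdiff.1 hk).2
        rw [Function.update_of_ne hkl] at h2
        exact (ENNReal.ofReal_le_ofReal_iff (hu'.1.1 k)).1 ((hz.1.2 k).trans_eq h2.symm)
    have h2 := Finset.sum_sdiff (Finset.subset_univ S) (f := z)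
    have h3 := Finset.sum_sdiff (Finset.subset_univ S) (f := u')
    have h4 := hz.1.1.2 S
    have h5 := hz.2
    linarith
  · simpa [hk] using hge k

end Clinching

end Market

namespace Market

theorem IsBase.convexComb {N M : Type} [Fintype N] [Fintype M] [DecidableEq N] {G : Market N M}
    {w : N → M → ℝ} {d : N → ℝ≥0∞} {u z : N → ℝ} (hu : G.IsBase w d u) (hz : G.IsBase w d z)
    {t : ℝ} (h0 : 0 ≤ t) (h1 : t ≤ 1) : G.IsBase w d (fun k => t * u k + (1 - t) * z k) := by
  have hsum : ∀ S : Finset N, ∑ k ∈ S, (t * u k + (1 - t) * z k) =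
      t * ∑ k ∈ S, u k + (1 - t) * ∑ k ∈ S, z k := fun S => by
    rw [Finset.sum_add_distrib, Finset.mul_sum, Finset.mul_sum]
  refine ⟨⟨⟨fun k => ?_, fun S => ?_⟩, fun k => ?_⟩, ?_⟩
  · have := hu.1.1.1 k
    have := hz.1.1.1 k
    have := sub_nonneg.2 h1
    positivity
  · rw [hsum]
    nlinarith [hu.1.1.2 S, hz.1.1.2 S]
  · have h : t * u k + (1 - t) * z k ≤ max (u k) (z k) := by
      nlinarith [le_max_left (u k) (z k), le_max_right (u k) (z k)]
    refine (ENNReal.ofReal_le_ofReal h).trans ?_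
    rcases max_choice (u k) (z k) with h | h <;> rw [h]
    exacts [hu.1.2 k, hz.1.2 k]
  · rw [hsum, hu.2, hz.2]
    ring

end Market

namespace PCA

open Market

/-! ### States of the auction -/

theorem demand_pay {B : ℝ≥0∞} {b p c X : ℝ} (hp : 0 ≤ p) (hc : 0 ≤ c) (hX : 0 ≤ X) :
    demand B b (p + c * X) c = demand B b p c - ENNReal.ofReal X := by
  unfold demand
  split_ifs with h1 h2
  · simp
  · have hc0 : ENNReal.ofReal c ≠ 0 := by
      simpa using lt_of_le_of_ne hc (Ne.symm h2)
    rw [ENNReal.ofReal_add hp (mul_nonneg hc hX), ENNReal.ofReal_mul hc, ← tsub_tsub,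
      ENNReal.sub_div fun _ _ => hc0, mul_comm, ENNReal.mul_div_cancel_right hc0 (by simp)]
  · simp

theorem pay_le_of_le_demand {B : ℝ≥0∞} {b p c X : ℝ} (hp : 0 ≤ p) (hc : 0 ≤ c) (hX : 0 ≤ X)
    (hB : ENNReal.ofReal p ≤ B) (hd : ENNReal.ofReal X ≤ demand B b p c) :
    ENNReal.ofReal (p + c * X) ≤ B := by
  unfold demand at hd
  split_ifs at hd with h1 h2
  · simpa [h2] using hB
  · have hc0 : ENNReal.ofReal c ≠ 0 := by
      simpa using lt_of_le_of_ne hc (Ne.symm h2)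
    rw [ENNReal.le_div_iff_mul_le (Or.inl hc0) (by simp), mul_comm, ← ENNReal.ofReal_mul hc] at hd
    rw [ENNReal.ofReal_add hp (mul_nonneg hc hX), add_comm]
    exact (add_le_add_left hd _).trans_eq (tsub_add_cancel_of_le hB)
  · have : X = 0 := le_antisymm (by simpa using hd) hX
    simpa [this] using hB

section General

variable {N M : Type} [Fintype N] [Fintype M] [DecidableEq N]

/-- The facts on prices and payments that hold throughout the auction. Buyers with a finite budget
have paid at least the price `a` for each unit. -/
structure Consistent (G : Market N M) (b : N → ℝ) (B : N → ℝ≥0∞) (a : ℝ) (s : State N M) :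
    Prop where
  mem_polytope : s.w ∈ G.polytope
  d_eq : ∀ i, s.d i = demand (B i) (b i) (s.p i) (s.c i)
  c_nonneg : ∀ i, 0 ≤ s.c i
  p_nonneg : ∀ i, 0 ≤ s.p i
  p_le : ∀ i, s.p i ≤ b i * ∑ j, s.w i j
  p_budget : ∀ i, ENNReal.ofReal (s.p i) ≤ B i
  le_p : ∀ i, B i ≠ ⊤ → a * ∑ j, s.w i j ≤ s.p i

variable {G : Market N M} {b : N → ℝ} {B : N → ℝ≥0∞} {a : ℝ} {s s' : State N M} {i : N}

omit [Fintype N] in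
theorem Consistent.capAfter_eq (hs : Consistent G b B a s) {X : ℝ} (hX : 0 ≤ X) :
    Function.update s.d i (demand (B i) (b i) (s.p i + s.c i * X) (s.c i)) =
      capAfter s.d i X := by
  rw [demand_pay (hs.p_nonneg i) (hs.c_nonneg i) hX, ← hs.d_eq i, capAfter]

omit [Fintype N] in
theorem sum_update_row (w : N → M → ℝ) (i : N) (ξ : M → ℝ) (k : N) :
    ∑ j, Function.update w i (w i + ξ) k j = ∑ j, w k j + if k = i then ∑ j, ξ j else 0 := by
  by_cases hk : k = i
  · subst hk; simp [Finset.sum_add_distrib]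
  · simp [hk]

/-- It is enough to know that buyers with a finite budget do not clinch at prices below `a`. -/
theorem Clinch.consistent (h : Clinch G b B i s s') (hs : Consistent G b B a s)
    (hpay : B i ≠ ⊤ → ∀ ξ ∈ G.clinchPolytope s.w s.d i, ∑ j, ξ j = 0 ∨ a ≤ s.c i) :
    Consistent G b B a s' := by
  obtain ⟨ξ, hξ, rfl⟩ := h
  obtain ⟨h0, hE, hP, hd, -⟩ := (mem_clinchPolytope_iff hs.mem_polytope).1 hξ.1
  have hX : 0 ≤ ∑ j, ξ j := Finset.sum_nonneg fun j _ => h0 j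
  have hd' := (hs.d_eq i) ▸ hd
  refine ⟨hP, fun k => ?_, hs.c_nonneg, fun k => ?_, fun k => ?_, fun k => ?_, fun k hk => ?_⟩ <;>
    simp only [sum_update_row] <;> by_cases hki : k = i
  · subst hki; simp
  · simpa [hki] using hs.d_eq k
  · subst hki; simpa using add_nonneg (hs.p_nonneg k) (mul_nonneg (hs.c_nonneg k) hX)
  · simpa [hki] using hs.p_nonneg k
  · subst hki
    simp only [Function.update_self, if_true, mul_add]
    refine add_le_add (hs.p_le k) ?_
    by_cases hcb : s.c k < b k
    · exact mul_le_mul_of_nonneg_right hcb.le hX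
    · have : ∑ j, ξ j = 0 := le_antisymm (by simpa [demand, hcb] using hd') hX
      simp [this]
  · simpa [hki] using hs.p_le k
  · subst hki
    simpa using pay_le_of_le_demand (hs.p_nonneg k) (hs.c_nonneg k) hX (hs.p_budget k) hd'
  · simpa [hki] using hs.p_budget k
  · subst hki
    simp only [Function.update_self, if_true, mul_add]
    refine add_le_add (hs.le_p k hk) ?_
    rcases hpay hk ξ hξ.1 with h | h
    · simp [h]
    · exact mul_le_mul_of_nonneg_right h hX
  · simpa [hki] using hs.le_p k hk

omit [Fintype N] in
theorem Clinch.c_eq (h : Clinch G b B i s s') : s'.c = s.c := by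
  obtain ⟨ξ, -, rfl⟩ := h; rfl

omit [Fintype N] in
theorem ClinchAll.induction {P : State N M → Prop}
    (hP : ∀ i s s', Clinch G b B i s s' → P s → P s') {L : List N}
    (h : ClinchAll G b B L s s') : P s → P s' := by
  induction h with
  | nil => exact id
  | cons h _ ih => exact fun hs => ih (hP _ _ _ h hs)

theorem Clinch.exists_base_eq_zero (h : Clinch G b B i s s') (hs : Consistent G b B a s)
    {k : N} (hbase : ∃ u, G.IsBase s.w s.d u ∧ u k = 0) :
    ∃ u, G.IsBase s'.w s'.d u ∧ u k = 0 := by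
  obtain ⟨u, hu, huk⟩ := hbase
  obtain ⟨ξ, hξ, rfl⟩ := h
  have hX : 0 ≤ ∑ j, ξ j := Finset.sum_nonneg fun j _ => hξ.1.1 j
  have := hu.clinch hs.mem_polytope hξ.1
  simp only [hs.capAfter_eq hX]
  refine ⟨_, this, le_antisymm ?_ (this.1.1.1 k)⟩
  by_cases hk : k = i
  · subst hk; simpa [huk] using hX
  · simp [hk, huk]

/-- After all buyers in a list have clinched, each of them could be left out without reducing
the amount of goods that can be sold. -/
theorem ClinchAll.exists_base_eq_zero {Q : State N M → Prop}
    (hQ : ∀ i s s', Clinch G b B i s s' → Q s → Q s')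
    (hQs : ∀ s, Q s → Consistent G b B a s ∧ ∃ u, G.IsBase s.w s.d u) {L : List N}
    (h : ClinchAll G b B L s s') (hs : Q s) :
    ∀ k ∈ L, ∃ u, G.IsBase s'.w s'.d u ∧ u k = 0 := by
  induction h with
  | nil => simp
  | @cons i L s₁ s₂ s₃ h hL ih =>
    intro k hk
    rcases List.mem_cons.1 hk with rfl | hk
    · have hbase : ∃ u, G.IsBase s₂.w s₂.d u ∧ u k = 0 := by
        obtain ⟨ξ, hξ, rfl⟩ := h
        have hX : 0 ≤ ∑ j, ξ j := Finset.sum_nonneg fun j _ => hξ.1.1 j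
        simp only [(hQs s₁ hs).1.capAfter_eq hX]
        exact exists_base_eq_zero_of_maximal (hQs s₁ hs).1.mem_polytope hξ (hQs s₁ hs).2
      exact (hL.induction (P := fun s => Q s ∧ ∃ u, G.IsBase s.w s.d u ∧ u k = 0)
        (fun i t t' ht hq => ⟨hQ i t t' ht hq.1, ht.exists_base_eq_zero (hQs t hq.1).1 hq.2⟩)
        ⟨hQ _ _ _ h hs, hbase⟩).2
    · exact ih (hQ _ _ _ h hs) k hk

omit [Fintype N] in
theorem Consistent.raise (hs : Consistent G b B a s) {ε : ℝ} (hε : 0 ≤ ε) (l : N) :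
    Consistent G b B a (raise b B ε l s) := by
  refine ⟨hs.mem_polytope, fun k => ?_, fun k => ?_, hs.p_nonneg, hs.p_le, hs.p_budget,
    hs.le_p⟩ <;> by_cases hk : k = l
  · subst hk; simp [PCA.raise]
  · simpa [PCA.raise, hk] using hs.d_eq k
  · subst hk; simpa [PCA.raise] using add_nonneg (hs.c_nonneg k) hε
  · simpa [PCA.raise, hk] using hs.c_nonneg k

/-! ### The potential -/

/-- The value attributed to a buyer with valuation `v` and budget `B` who has got `x` units for a
payment of `p`, faces the price `c` and is going to get `y` more units. Up to the satiation amount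
`κ = B / v` a future unit is worth `v`, and beyond that it is worth `c + ε`. A past unit that has
been bought at the price `π` counts `v - a + π` up to the amount `κ`, and `π + ε` beyond. The value
of a buyer with an infinite budget is `v * (x + y)`. -/
noncomputable def buyerPotential (a ε v : ℝ) (B : ℝ≥0∞) (x p c y : ℝ) : ℝ :=
  if B = ⊤ then v * (x + y) else
    v * min (x + y) (B.toReal / v) + (c + ε) * max (x + y - B.toReal / v) 0
      - a * min x (B.toReal / v) - c * max (x - B.toReal / v) 0 + p

theorem min_add_max (x κ : ℝ) : min x κ + max (x - κ) 0 = x := by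
  rcases le_total x κ with h | h
  · rw [min_eq_left h, max_eq_right (by linarith)]; ring
  · rw [min_eq_right h, max_eq_left (by linarith)]; ring

theorem buyerPotential_clinch {ε v : ℝ} {β : ℝ≥0∞} {x p c y X : ℝ} (hX : 0 ≤ X)
    (h : β ≠ ⊤ → X = 0 ∨ a ≤ c) :
    buyerPotential a ε v β x p c y ≤ buyerPotential a ε v β (x + X) (p + c * X) c (y - X) := by
  unfold buyerPotential
  rw [show x + X + (y - X) = x + y by ring]
  split_ifs with hβ
  · rfl
  · rcases h hβ with rfl | h
    · simp
    · have h1 := min_add_max x (β.toReal / v)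
      have h2 := min_add_max (x + X) (β.toReal / v)
      have h3 : min x (β.toReal / v) ≤ min (x + X) (β.toReal / v) :=
        min_le_min_right _ (by linarith)
      have h4 : max (x + X - β.toReal / v) 0 =
        max (x - β.toReal / v) 0 + X - (min (x + X) (β.toReal / v) - min x (β.toReal / v)) := by
        linarith
      rw [h4]
      nlinarith

theorem buyerPotential_gain {ε v : ℝ} {β : ℝ≥0∞} {x p c y z : ℝ} (hyz : y ≤ z)
    (h : y = z ∨ c + ε ≤ v) :
    buyerPotential a ε v β x p c y + (c + ε) * (z - y) ≤ buyerPotential a ε v β x p c z := by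
  rcases h with rfl | h
  · simp
  unfold buyerPotential
  split_ifs with hβ
  · nlinarith
  · have h1 := min_add_max (x + y) (β.toReal / v)
    have h2 := min_add_max (x + z) (β.toReal / v)
    have h3 : min (x + y) (β.toReal / v) ≤ min (x + z) (β.toReal / v) :=
      min_le_min_right _ (by linarith)
    have h4 : max (x + z - β.toReal / v) 0 = max (x + y - β.toReal / v) 0 + (z - y) -
        (min (x + z) (β.toReal / v) - min (x + y) (β.toReal / v)) := by linarith
    rw [h4]
    nlinarith

/-- When the price of a buyer is raised, each unit she loses is worth at most `c + ε`: either she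
drops out at `v = c + ε`, or she only loses units beyond the satiation amount. -/
theorem buyerPotential_raise {ε v : ℝ} {β : ℝ≥0∞} {x p c y z : ℝ} (hε : 0 ≤ ε) (hz : 0 ≤ z)
    (hzy : z ≤ y) (h : z = y ∨ v ≤ c + ε ∨ (β ≠ ⊤ ∧ β.toReal / v ≤ x + z)) :
    buyerPotential a ε v β x p c y - (c + ε) * (y - z) ≤
      buyerPotential a ε v β x p (c + ε) z := by
  unfold buyerPotential
  split_ifs with hβ
  · rcases h with rfl | h | h
    · simp
    · nlinarith
    · exact absurd hβ h.1
  · have h1 := min_add_max (x + y) (β.toReal / v)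
    have h2 := min_add_max (x + z) (β.toReal / v)
    have h3 : min (x + z) (β.toReal / v) ≤ min (x + y) (β.toReal / v) :=
      min_le_min_right _ (by linarith)
    have h4 : max (x - β.toReal / v) 0 ≤ max (x + z - β.toReal / v) 0 :=
      max_le_max_right _ (by linarith)
    have h5 : max (x + y - β.toReal / v) 0 = max (x + z - β.toReal / v) 0 + (y - z) -
        (min (x + y) (β.toReal / v) - min (x + z) (β.toReal / v)) := by linarith
    have h6 : (v - (c + ε)) *
        (min (x + y) (β.toReal / v) - min (x + z) (β.toReal / v)) ≤ 0 := by
      rcases h with rfl | h | h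
      · simp
      · exact mul_nonpos_of_nonpos_of_nonneg (by linarith) (by linarith)
      · rw [min_eq_right h.2, min_eq_right (by linarith)]
        simp
    rw [h5]
    nlinarith [mul_nonneg hε (sub_nonneg.2 h4)]

/-- The potential of a state, when the buyers are going to get the amounts `u`. -/
noncomputable def potential (b : N → ℝ) (B : N → ℝ≥0∞) (a ε : ℝ) (s : State N M) (u : N → ℝ) : ℝ :=
  ∑ i, buyerPotential a ε (b i) (B i) (∑ j, s.w i j) (s.p i) (s.c i) (u i)

theorem Clinch.potential_le {ε L : ℝ} (h : Clinch G b B i s s') (hs : Consistent G b B a s)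
    (hpay : B i ≠ ⊤ → ∀ ξ ∈ G.clinchPolytope s.w s.d i, ∑ j, ξ j = 0 ∨ a ≤ s.c i)
    (hpot : ∃ u, G.IsBase s.w s.d u ∧ L ≤ potential b B a ε s u) :
    ∃ u, G.IsBase s'.w s'.d u ∧ L ≤ potential b B a ε s' u := by
  obtain ⟨u, hu, hL⟩ := hpot
  obtain ⟨ξ, hξ, rfl⟩ := h
  have hX : 0 ≤ ∑ j, ξ j := Finset.sum_nonneg fun j _ => hξ.1.1 j
  have hclinch := hu.clinch hs.mem_polytope hξ.1
  simp only [hs.capAfter_eq hX]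
  refine ⟨_, hclinch, hL.trans (Finset.sum_le_sum fun k _ => ?_)⟩
  simp only [sum_update_row]
  by_cases hk : k = i
  · subst hk
    simpa using buyerPotential_clinch hX fun hB => hpay hB ξ hξ.1
  · simp [hk]

/-- Raising the price of a buyer `l` who has the lowest price does not reduce the potential, as
the units that she loses can be taken over by others, for whom they are worth at least as much. -/
theorem potential_raise {ε L : ℝ} {l : N} (hε : 0 < ε) (hb : ∀ i, 0 < b i)
    (hs : Consistent G b B a s) (hl : ∀ k, s.c l ≤ s.c k)
    (hmul : ∀ k, s.c k < b k → s.c k + ε ≤ b k)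
    (hzero : ∃ u, G.IsBase s.w s.d u ∧ u l = 0)
    (hpot : ∃ u, G.IsBase s.w s.d u ∧ L ≤ potential b B a ε s u) :
    ∃ u, G.IsBase (raise b B ε l s).w (raise b B ε l s).d u ∧
      L ≤ potential b B a ε (raise b B ε l s) u := by
  obtain ⟨u, hu, hL⟩ := hpot
  obtain ⟨z, hz, hzl⟩ := hzero
  obtain ⟨z, hz, hzl, hle⟩ := hu.exists_drop hs.mem_polytope hz hzl
  have hul := hu.1.1.1 l
  set d' := demand (B l) (b l) (s.p l) (s.c l + ε) with hd'
  -- The amount `y` that buyer `l` keeps: as much as her new demand allows.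
  obtain ⟨y, hy0, hyu, hyd, hy⟩ : ∃ y, 0 ≤ y ∧ y ≤ u l ∧ ENNReal.ofReal y ≤ d' ∧
      (y = u l ∨ b l ≤ s.c l + ε ∨ (B l ≠ ⊤ ∧ (B l).toReal / b l ≤ ∑ j, s.w l j + y)) := by
    by_cases h : ENNReal.ofReal (u l) ≤ d'
    · exact ⟨u l, hul, le_rfl, h, Or.inl rfl⟩
    · have htop : d' ≠ ⊤ := fun h' => h (h' ▸ le_top)
      refine ⟨d'.toReal, ENNReal.toReal_nonneg, ?_, (ENNReal.ofReal_toReal htop).le, Or.inr ?_⟩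
      · exact (ENNReal.le_ofReal_iff_toReal_le htop hul).1 (not_le.1 h).le
      · by_cases hc : b l ≤ s.c l + ε
        · exact Or.inl hc
        · have hcpos : 0 < s.c l + ε := add_pos_of_nonneg_of_pos (hs.c_nonneg l) hε
          have hcne : ENNReal.ofReal (s.c l + ε) ≠ 0 := by simpa using hcpos
          have hd2 : d' = (B l - ENNReal.ofReal (s.p l)) / ENNReal.ofReal (s.c l + ε) := by
            rw [hd', demand, if_pos (not_le.1 hc), if_neg hcpos.ne']
          have hB : B l ≠ ⊤ := by
            rintro hB
            apply htop
            rw [hd2, hB, ENNReal.top_sub ENNReal.ofReal_ne_top,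
              ENNReal.top_div_of_ne_top ENNReal.ofReal_ne_top]
          refine Or.inr ⟨hB, ?_⟩
          have hp := hs.p_nonneg l
          have hpB := hs.p_budget l
          rw [hd2, ENNReal.toReal_div, ENNReal.toReal_sub_of_le hpB hB,
            ENNReal.toReal_ofReal hp, ENNReal.toReal_ofReal hcpos.le]
          have hpB' : s.p l ≤ (B l).toReal := (ENNReal.ofReal_le_iff_le_toReal hB).1 hpB
          have h1 : ((B l).toReal - s.p l) / b l ≤ ((B l).toReal - s.p l) / (s.c l + ε) :=
            div_le_div_of_nonneg_left (by linarith) hcpos (not_le.1 hc).le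
          have h2 : s.p l / b l ≤ ∑ j, s.w l j := by
            rw [div_le_iff₀ (hb l), mul_comm]
            exact hs.p_le l
          rw [sub_div] at h1
          linarith
  obtain ⟨t, ht0, ht1, hty⟩ : ∃ t, 0 ≤ t ∧ t ≤ 1 ∧ t * u l = y := by
    rcases hul.eq_or_lt with h | h
    · exact ⟨1, zero_le_one, le_rfl, by linarith⟩
    · exact ⟨y / u l, by positivity, (div_le_one h).2 hyu, div_mul_cancel₀ y h.ne'⟩
  have hcomb := hu.convexComb hz ht0 ht1
  set q : N → ℝ := fun k => t * u k + (1 - t) * z k with hq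
  have hql : q l = y := by simp [hq, hzl, hty]
  have hqk : ∀ k, k ≠ l → u k ≤ q k := fun k hk => by
    simp only [hq]
    nlinarith [hle k hk]
  refine ⟨q, ⟨⟨hcomb.1.1, fun k => ?_⟩, hcomb.2⟩, hL.trans ?_⟩
  · by_cases hk : k = l
    · subst hk; simpa [PCA.raise, hql] using hyd
    · simpa [PCA.raise, hk] using hcomb.1.2 k
  · have hloss := buyerPotential_raise (a := a) (p := s.p l) hε.le hy0 hyu hy
    have hgain : ∀ k ∈ Finset.univ.erase l,
        buyerPotential a ε (b k) (B k) (∑ j, s.w k j) (s.p k) (s.c k) (u k) +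
          (s.c l + ε) * (q k - u k) ≤
        buyerPotential a ε (b k) (B k) (∑ j, s.w k j) (s.p k) ((raise b B ε l s).c k) (q k) := by
      intro k hk
      have hkl := Finset.ne_of_mem_erase hk
      have h1 := hqk k hkl
      have h2 : (s.c l + ε) * (q k - u k) ≤ (s.c k + ε) * (q k - u k) :=
        mul_le_mul_of_nonneg_right (by linarith [hl k]) (by linarith)
      have h3 : u k = q k ∨ s.c k + ε ≤ b k := by
        by_cases hc : s.c k < b k
        · exact Or.inr (hmul k hc)
        · left
          have hd0 : s.d k = 0 := by rw [hs.d_eq k, demand, if_neg hc]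
          have hq0 : q k ≤ 0 := by simpa [hd0] using hcomb.1.2 k
          linarith [hu.1.1.1 k]
      have h4 := buyerPotential_gain (a := a) (β := B k) (x := ∑ j, s.w k j) (p := s.p k) h1 h3
      simp only [PCA.raise, Function.update_of_ne hkl]
      linarith
    have hsum := Finset.sum_le_sum hgain
    rw [Finset.sum_add_distrib, ← Finset.mul_sum, Finset.sum_sub_distrib] at hsum
    have e1 := Finset.add_sum_erase Finset.univ q (Finset.mem_univ l)
    have e2 := Finset.add_sum_erase Finset.univ u (Finset.mem_univ l)
    have e3 : ∑ k ∈ Finset.univ.erase l, q k - ∑ k ∈ Finset.univ.erase l, u k = u l - y := by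
      linarith [hcomb.2, hu.2]
    rw [e3] at hsum
    unfold potential
    rw [← Finset.add_sum_erase _ _ (Finset.mem_univ l),
      ← Finset.add_sum_erase _ _ (Finset.mem_univ l), hql]
    simp only [PCA.raise, Function.update_self] at hsum ⊢
    linarith

end General

end PCA

namespace Market

/-! ### Virtual buyers and clocks -/

section Virtual

variable {N M : Type} [Fintype N] [Fintype M] [DecidableEq N] [DecidableEq M] {G : Market N M}
  {w : N ⊕ M → M → ℝ} {d : N ⊕ M → ℝ≥0∞} {ξ : M → ℝ}

theorem residualRank_withVirtual (hw : w ∈ G.withVirtual.polytope) {j : M} {S : Finset (N ⊕ M)}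
    (hS : Sum.inr j ∈ S) :
    G.withVirtual.residualRank w j S = G.f j (G.nbr j) - ∑ k, w k j := by
  have hmem : Sum.inr j ∈ G.withVirtual.nbr j := by simp [withVirtual]
  refine le_antisymm ?_ ?_
  · have := residualRank_le (G := G.withVirtual) (w := w) (j := j) (S := S)
      Finset.inter_subset_right subset_rfl
    rw [sum_nbr_eq hw.2.1] at this
    simpa [withVirtual] using this
  · obtain ⟨T, h1, h2, h3⟩ := exists_residualRank_eq G.withVirtual w j S
    have hT : Sum.inr j ∈ T := h1 (Finset.mem_inter.2 ⟨hS, hmem⟩)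
    have hf : G.withVirtual.f j T = G.f j (G.nbr j) := by simp [withVirtual, hT]
    rw [h3, hf]
    linarith [Finset.sum_le_sum_of_subset_of_nonneg (f := fun k => w k j) (Finset.subset_univ T)
      fun k _ _ => hw.1 k j]

/-- As long as the demand of the virtual buyer of seller `j` is infinite, no other buyer clinches
from `j`, since the virtual buyer could buy all remaining goods of `j`. -/
theorem clinch_eq_zero_of_virtual (hw : w ∈ G.withVirtual.polytope) {i : N} {j : M}
    (hξ : ξ ∈ G.withVirtual.clinchPolytope w d (Sum.inl i)) (hd : d (Sum.inr j) = ⊤) :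
    ξ j = 0 := by
  obtain ⟨h0, hE, hP, -, hsub⟩ := (mem_clinchPolytope_iff hw).1 hξ
  set R := G.withVirtual.residualRank w j {Sum.inr j} with hR
  have hrk := isPolymatroidRank_residualRank hw j
  have hsup : ∀ S, G.withVirtual.residualRank w j S ≤ G.withVirtual.supply w S := fun S =>
    Finset.single_le_sum (f := fun j => G.withVirtual.residualRank w j S) (fun j' _ => by
      have hr := isPolymatroidRank_residualRank hw j'
      simpa [hr.empty] using hr.mono ∅ S (by simp)) (Finset.mem_univ j)
  have hR0 : 0 ≤ R := by simpa [hrk.empty] using hrk.mono ∅ {Sum.inr j} (by simp)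
  have hmem : (Pi.single (Sum.inr j) R : N ⊕ M → ℝ) ∈ cappedPolymatroid (G.withVirtual.supply w)
      (Function.update d (Sum.inl i) 0) := by
    refine ⟨⟨fun k => ?_, fun S => ?_⟩, fun k => ?_⟩
    · by_cases hk : k = Sum.inr j
      · subst hk; simpa using hR0
      · simp [hk]
    · rw [Finset.sum_pi_single']
      split_ifs with hS
      · exact (hrk.mono _ _ (by simpa using hS)).trans (hsup S)
      · have hr := isPolymatroidRank_supply hw
        simpa [hr.empty] using hr.mono ∅ S (by simp)
    · by_cases hk : k = Sum.inr j
      · subst hk; simp [hd]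
      · simp [hk]
  have h1 := (hsub hmem).1.2 {Sum.inr j}
  simp only [Finset.sum_singleton, Pi.single_eq_same] at h1
  have h2 : G.withVirtual.supply (Function.update w (Sum.inl i) (w (Sum.inl i) + ξ))
      {Sum.inr j} = G.withVirtual.residualRank
        (Function.update w (Sum.inl i) (w (Sum.inl i) + ξ)) j {Sum.inr j} := by
    refine Finset.sum_eq_single j (fun j' _ hj' => ?_) (by simp)
    have hr := isPolymatroidRank_residualRank hP j'
    rw [← hr.empty]
    simp [residualRank, withVirtual, hj'.symm]
  rw [h2, residualRank_withVirtual hP (by simp), sum_update_add,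
    if_pos (Finset.mem_univ _)] at h1
  rw [hR, residualRank_withVirtual hw (by simp)] at h1
  exact le_antisymm (by linarith) (h0 j)

end Virtual

end Market

namespace PCA

open Market

section Auction

variable {n m : ℕ}

/-- The price of buyer `i` after `t` iterations: the number of earlier iterations whose number is
congruent to the index of `i` modulo `n + m`, times `ε`. -/
noncomputable def clock (n m : ℕ) (ε : ℝ) (t : ℕ) (i : Fin n ⊕ Fin m) : ℝ :=
  ((t + (n + m) - 1 - (finSumFinEquiv i : ℕ)) / (n + m) : ℕ) * ε

theorem succ_add_sub_div {q t k : ℕ} (hk : k < q) :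
    (t + 1 + q - 1 - k) / q = (t + q - 1 - k) / q + if k = t % q then 1 else 0 := by
  rw [show t + 1 + q - 1 - k = (t + q - 1 - k) + 1 by omega, Nat.succ_div]
  congr 1
  have : q ∣ t + q - 1 - k + 1 ↔ k = t % q := by
    rw [show t + q - 1 - k + 1 = t + q - k by omega]
    have h1 : q ∣ t + q - k ↔ t + q ≡ k [MOD q] := by
      rw [Nat.ModEq.comm]
      exact (Nat.modEq_iff_dvd' (by omega)).symm
    rw [h1, Nat.ModEq, Nat.add_mod_right, Nat.mod_eq_of_lt hk, eq_comm]
  simp only [this]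

theorem clock_zero (ε : ℝ) (i : Fin n ⊕ Fin m) : clock n m ε 0 i = 0 := by
  have := (finSumFinEquiv i).isLt
  rw [clock, Nat.div_eq_of_lt (by omega)]
  simp

theorem clock_succ (ε : ℝ) {t : ℕ} {l : Fin n ⊕ Fin m}
    (hl : (finSumFinEquiv l : ℕ) = t % (n + m)) :
    clock n m ε (t + 1) = Function.update (clock n m ε t) l (clock n m ε t l + ε) := by
  ext i
  by_cases hi : i = l
  · subst hi
    rw [Function.update_self, clock, succ_add_sub_div (finSumFinEquiv i).isLt, if_pos hl, clock]
    push_cast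
    ring
  · rw [Function.update_of_ne hi, clock, succ_add_sub_div (finSumFinEquiv i).isLt, if_neg, clock,
      add_zero]
    rintro h
    exact hi (finSumFinEquiv.injective (Fin.ext (h.trans hl.symm)))

theorem clock_le_of_le {ε : ℝ} (hε : 0 ≤ ε) {t : ℕ} {i k : Fin n ⊕ Fin m}
    (h : (finSumFinEquiv i : ℕ) ≤ (finSumFinEquiv k : ℕ)) :
    clock n m ε t k ≤ clock n m ε t i := by
  refine mul_le_mul_of_nonneg_right (Nat.cast_le.2 (Nat.div_le_div_right ?_)) hε
  omega

theorem clock_min {ε : ℝ} (hε : 0 ≤ ε) {t : ℕ} {l : Fin n ⊕ Fin m}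
    (hl : (finSumFinEquiv l : ℕ) = t % (n + m)) (k : Fin n ⊕ Fin m) :
    clock n m ε t l ≤ clock n m ε t k := by
  refine mul_le_mul_of_nonneg_right (Nat.cast_le.2 ?_) hε
  have hk := (finSumFinEquiv k).isLt
  rw [hl]
  have h1 : (t + (n + m) - 1 - t % (n + m)) / (n + m) = t / (n + m) := by
    have h2 := Nat.div_add_mod t (n + m)
    have h3 : t + (n + m) - 1 - t % (n + m) = (n + m - 1) + (n + m) * (t / (n + m)) := by omega
    rw [h3, Nat.add_mul_div_left _ _ (by omega), Nat.div_eq_of_lt (by omega), zero_add]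
  rw [h1]
  exact Nat.div_le_div_right (by omega)

theorem mem_buyerOrder (i : Fin n ⊕ Fin m) : i ∈ buyerOrder n m :=
  List.mem_map.2 ⟨finSumFinEquiv i, List.mem_finRange _, finSumFinEquiv.symm_apply_apply i⟩

/-! ### Invariants of the auction -/

variable {G : Market (Fin n) (Fin m)} {v : Fin n → ℝ} {ρ : Fin m → ℝ} {B : Fin n → ℝ≥0∞}
  {ε a : ℝ}

/-- Buyers with a finite budget are not virtual, so that they pay at least the price at which the
virtual buyers drop out. -/
theorem price_of_clinch {s : State (Fin n ⊕ Fin m) (Fin m)}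
    (hs : Consistent G.withVirtual (Sum.elim v ρ) (Sum.elim B fun _ => ⊤) a s)
    (ha : ∀ j, a ≤ ρ j) (hc : ∀ i j, s.c (Sum.inr j) ≤ s.c (Sum.inl i)) (i : Fin n ⊕ Fin m)
    (hB : (Sum.elim B fun _ => ⊤ : Fin n ⊕ Fin m → ℝ≥0∞) i ≠ ⊤) :
    ∀ ξ ∈ G.withVirtual.clinchPolytope s.w s.d i, ∑ j, ξ j = 0 ∨ a ≤ s.c i := by
  rcases i with i | j
  · intro ξ hξ
    by_cases h : a ≤ s.c (Sum.inl i)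
    · exact Or.inr h
    · refine Or.inl (Finset.sum_eq_zero fun j _ =>
        clinch_eq_zero_of_virtual hs.mem_polytope hξ ?_)
      have hlt : s.c (Sum.inr j) < ρ j := by linarith [hc i j, ha j, not_le.1 h]
      rw [hs.d_eq, demand, Sum.elim_inr, Sum.elim_inr, if_pos hlt]
      split_ifs with h0
      · rfl
      · rw [ENNReal.top_sub ENNReal.ofReal_ne_top, ENNReal.top_div_of_ne_top ENNReal.ofReal_ne_top]
  · exact absurd rfl hB

theorem consistent_init (hv : ∀ i, 0 < Sum.elim v ρ i) :
    Consistent G.withVirtual (Sum.elim v ρ) (Sum.elim B fun _ => ⊤) a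
      (State.init (Fin n ⊕ Fin m) (Fin m)) where
  mem_polytope := ⟨fun _ _ => le_rfl, fun _ _ _ => rfl, fun j F hF => by
    simpa [State.init, G.withVirtual.f_empty] using
      G.withVirtual.f_mono j ∅ F (Finset.empty_subset F) hF⟩
  d_eq i := by simp [State.init, demand, hv i]
  c_nonneg _ := le_rfl
  p_nonneg _ := le_rfl
  p_le _ := by simp [State.init]
  p_budget _ := by simp [State.init]
  le_p _ _ := by simp [State.init]

/-- Throughout the auction, prices are given by the clocks and the potential of some base stays
above its initial value. -/
theorem Reach.invariant {L : ℝ} (hadm : Admissible v ρ ε) (ha : ∀ j, a ≤ ρ j)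
    (hL : ∃ u, G.withVirtual.IsBase 0 (fun _ => ⊤) u ∧
      L ≤ potential (Sum.elim v ρ) (Sum.elim B fun _ => ⊤) a ε
        (State.init (Fin n ⊕ Fin m) (Fin m)) u)
    {t : ℕ} {s : State (Fin n ⊕ Fin m) (Fin m)}
    (h : Reach G.withVirtual (Sum.elim v ρ) (Sum.elim B fun _ => ⊤) ε t s) :
    Consistent G.withVirtual (Sum.elim v ρ) (Sum.elim B fun _ => ⊤) a s ∧
      s.c = clock n m ε t ∧ ∃ u, G.withVirtual.IsBase s.w s.d u ∧
        L ≤ potential (Sum.elim v ρ) (Sum.elim B fun _ => ⊤) a ε s u := by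
  obtain ⟨hε, hadm⟩ := hadm
  induction h with
  | init => exact ⟨consistent_init fun i => (hadm i).1, funext fun i => (clock_zero ε i).symm, hL⟩
  | @step t s s' l hs hd hc hl ih =>
    set Q : State (Fin n ⊕ Fin m) (Fin m) → Prop := fun s =>
      Consistent G.withVirtual (Sum.elim v ρ) (Sum.elim B fun _ => ⊤) a s ∧
      s.c = clock n m ε t ∧ ∃ u, G.withVirtual.IsBase s.w s.d u ∧
        L ≤ potential (Sum.elim v ρ) (Sum.elim B fun _ => ⊤) a ε s u with hQ
    have hstep : ∀ i r r', Clinch G.withVirtual (Sum.elim v ρ) (Sum.elim B fun _ => ⊤) i r r' →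
        Q r → Q r' := by
      rintro i r r' hr ⟨h1, h2, h3⟩
      have hpay := price_of_clinch h1 ha (fun i j => by
        rw [h2]
        refine clock_le_of_le hε.le ?_
        simp
        omega) i
      exact ⟨hr.consistent h1 hpay, hr.c_eq.trans h2, hr.potential_le h1 hpay h3⟩
    obtain ⟨h1, h2, h3⟩ := hc.induction hstep ih
    have hzero := hc.exists_base_eq_zero hstep
      (fun r hr => ⟨hr.1, hr.2.2.imp fun u hu => hu.1⟩) ih l (mem_buyerOrder l)
    refine ⟨h1.raise hε.le l, ?_, potential_raise hε (fun i => (hadm i).1) h1 (fun k => ?_)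
      (fun k hk => ?_) hzero h3⟩
    · rw [clock_succ ε hl, ← h2]
      rfl
    · rw [h2]
      exact clock_min hε.le hl k
    · -- Prices and valuations are multiples of `ε`.
      rw [h2, clock] at hk ⊢
      obtain ⟨κ, hκ⟩ := (hadm k).2
      rw [hκ] at hk ⊢
      have := (mul_lt_mul_iff_left₀ hε).1 hk
      have : ((t + (n + m) - 1 - (finSumFinEquiv k : ℕ)) / (n + m) : ℕ) + 1 ≤ κ := by
        exact_mod_cast this
      have : (((t + (n + m) - 1 - (finSumFinEquiv k : ℕ)) / (n + m) : ℕ) : ℝ) + 1 ≤ κ := by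
        exact_mod_cast this
      nlinarith

/-! ### Existence of outcomes -/

theorem zero_mem_polytope (G : Market (Fin n) (Fin m)) :
    (0 : Fin n → Fin m → ℝ) ∈ G.polytope :=
  ⟨fun _ _ => le_rfl, fun _ _ _ => rfl, fun j F hF => by
    simpa [G.f_empty] using G.f_mono j ∅ F (Finset.empty_subset F) hF⟩

/-- The transactions in the modified market where each virtual buyer gets what her seller
keeps. -/
noncomputable def withKept (G : Market (Fin n) (Fin m)) (w : Fin n → Fin m → ℝ) :
    Fin n ⊕ Fin m → Fin m → ℝ :=
  Sum.elim w fun k j => if k = j then G.f j (G.nbr j) - ∑ i, w i j else 0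

theorem sum_withKept (G : Market (Fin n) (Fin m)) (w : Fin n → Fin m → ℝ) (j : Fin m) :
    ∑ k, withKept G w k j = G.f j (G.nbr j) := by
  simp [withKept]

theorem withKept_mem_polytope {w : Fin n → Fin m → ℝ} (hw : w ∈ G.polytope) :
    withKept G w ∈ G.withVirtual.polytope := by
  have h0 : ∀ k j, 0 ≤ withKept G w k j := by
    rintro (i | k) j
    · exact hw.1 i j
    · simp only [withKept, Sum.elim_inr]
      split_ifs
      · have := hw.2.2 j _ subset_rfl
        rw [sum_nbr_eq hw.2.1] at this
        linarith
      · rfl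
  refine ⟨h0, ?_, fun j F hF => ?_⟩
  · rintro (i | k) j hk
    · exact hw.2.1 i j (by simpa [withVirtual] using hk)
    · simp only [withVirtual, Finset.inr_mem_disjSum, Finset.mem_singleton] at hk
      simp [withKept, hk]
  · by_cases hj : Sum.inr j ∈ F
    · refine (Finset.sum_le_sum_of_subset_of_nonneg (Finset.subset_univ F)
        fun k _ _ => h0 k j).trans_eq ?_
      rw [sum_withKept]
      simp [withVirtual, hj]
    · have hl : F.toLeft ⊆ G.nbr j := fun i hi => by
        simpa [withVirtual] using hF (Finset.mem_toLeft.1 hi)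
      have hr : ∑ k ∈ F.toRight, withKept G w (Sum.inr k) j = 0 :=
        Finset.sum_eq_zero fun k hk => if_neg fun h : k = j => hj (h ▸ Finset.mem_toRight.1 hk)
      rw [← Finset.toLeft_disjSum_toRight (u := F), Finset.sum_disjSum, hr, add_zero]
      simpa [withVirtual, hj, withKept] using hw.2.2 j _ hl

theorem isBase_withKept {w : Fin n → Fin m → ℝ} (hw : w ∈ G.polytope) :
    G.withVirtual.IsBase 0 (fun _ => ⊤) fun k => ∑ j, withKept G w k j := by
  have h0 : (0 : Fin n ⊕ Fin m → Fin m → ℝ) ∈ G.withVirtual.polytope :=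
    mem_polytope_of_le (withKept_mem_polytope hw) (fun _ _ => le_rfl)
      (withKept_mem_polytope hw).1
  refine ⟨(mem_cappedPolymatroid_supply_iff h0).2 ⟨withKept G w, ⟨(withKept_mem_polytope hw).1,
    (withKept_mem_polytope hw).2.1, by simpa using withKept_mem_polytope hw, fun _ => le_top⟩,
    fun _ => rfl⟩, ?_⟩
  rw [Finset.sum_comm, supply_univ h0]
  refine Finset.sum_congr rfl fun j _ => ?_
  rw [sum_withKept]
  simp [withVirtual]

theorem exists_clinchAll {N M : Type} [Fintype N] [Fintype M] [DecidableEq N] {G : Market N M}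
    {b : N → ℝ} {B : N → ℝ≥0∞} (L : List N) {s : State N M} (hs : s.w ∈ G.polytope) :
    ∃ s', ClinchAll G b B L s s' := by
  induction L generalizing s with
  | nil => exact ⟨s, .nil s⟩
  | cons i L ih =>
    obtain ⟨ξ, hξ⟩ := exists_maximal_clinch hs s.d i
    obtain ⟨s'', h⟩ := @ih { w := Function.update s.w i (s.w i + ξ)
                             p := Function.update s.p i (s.p i + s.c i * ∑ j, ξ j)
                             r := fun j => s.r j + s.c i * ξ j
                             c := s.c
                             d := Function.update s.d i
                               (demand (B i) (b i) (s.p i + s.c i * ∑ j, ξ j) (s.c i)) }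
      ((mem_clinchPolytope_iff hs).1 hξ.1).2.2.1
    exact ⟨s'', .cons ⟨ξ, hξ, rfl⟩ h⟩

theorem exists_outcome (hn : 0 < n) (hadm : Admissible v ρ ε) :
    ∃ A, Outcome G v ρ B ε A := by
  by_contra! hcon
  have hinv := fun {t : ℕ} {s : State (Fin n ⊕ Fin m) (Fin m)} =>
    Reach.invariant (G := G) (B := B) (a := 0) (t := t) (s := s) hadm
      (fun j => (hadm.2 (Sum.inr j)).1.le)
      ⟨_, isBase_withKept (zero_mem_polytope G), le_rfl⟩
  have hreach : ∀ t, ∃ s, Reach G.withVirtual (Sum.elim v ρ) (Sum.elim B fun _ => ⊤) ε t s := by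
    intro t
    induction t with
    | zero => exact ⟨_, .init⟩
    | succ t ih =>
      obtain ⟨s, hs⟩ := ih
      have hd : ∃ i, s.d i ≠ 0 := by
        by_contra! h
        exact hcon _ ⟨t, s, hs, h, rfl⟩
      obtain ⟨s', hs'⟩ := exists_clinchAll (b := Sum.elim v ρ) (B := Sum.elim B fun _ => ⊤)
        (buyerOrder n m) (hinv hs).1.mem_polytope
      exact ⟨_, .step (l := finSumFinEquiv.symm ⟨t % (n + m), Nat.mod_lt _ (by omega)⟩) hs hd hs'
        (by simp)⟩
  -- After this number of iterations, every price has reached the valuation.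
  choose κ hκ using fun i => (hadm.2 i).2
  set K := ∑ i, κ i
  obtain ⟨s, hs⟩ := hreach (K * (n + m))
  obtain ⟨h1, h2, -⟩ := hinv hs
  refine hcon _ ⟨_, s, hs, fun i => ?_, rfl⟩
  rw [h1.d_eq, demand, if_neg]
  rw [not_lt, h2, clock, hκ i]
  refine mul_le_mul_of_nonneg_right (Nat.cast_le.2 ?_) hadm.1.le
  have := (finSumFinEquiv i).isLt
  refine (Finset.single_le_sum (f := κ) (fun _ _ => Nat.zero_le _) (Finset.mem_univ i)).trans ?_
  rw [Nat.le_div_iff_mul_le (by omega)]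
  change K * (n + m) ≤ _
  omega

end Auction

end PCA

namespace PCA

open Market

/-! ### The approximation guarantee -/

theorem le_buyerPotential_init {a ε v y : ℝ} {β : ℝ≥0∞} (hε : 0 ≤ ε) (hv : 0 < v)
    (hy : 0 ≤ y) : (min (ENNReal.ofReal (v * y)) β).toReal ≤ buyerPotential a ε v β 0 0 0 y := by
  have hvy : 0 ≤ v * y := by positivity
  have hκ : 0 ≤ β.toReal / v := by positivity
  unfold buyerPotential
  split_ifs with hβ
  · simp [hβ, hvy]
  · rw [ENNReal.toReal_min ENNReal.ofReal_ne_top hβ, ENNReal.toReal_ofReal hvy, min_eq_left hκ,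
      mul_min_of_nonneg _ _ hv.le, mul_div_cancel₀ _ hv.ne']
    simp only [zero_add, zero_mul, mul_zero, sub_zero, add_zero]
    have := mul_nonneg hε (le_max_right (y - β.toReal / v) 0)
    linarith

/-- The only place where the bound on `ε` matters: it makes the charge of `ε` for each unit beyond
the satiation amount negligible against the units up to it. -/
theorem buyerPotential_final_le {a ε v x p c : ℝ} {β : ℝ≥0∞} (ha : 0 < a) (hε : 0 ≤ ε)
    (hav : a ≤ v) (hεa : ε * (v - a) ≤ a ^ 2) (hx : 0 ≤ x) (hp : p ≤ v * x)
    (hpβ : ENNReal.ofReal p ≤ β) (hap : β ≠ ⊤ → a * x ≤ p) :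
    buyerPotential a ε v β x p c 0 ≤ 2 * (min (ENNReal.ofReal (v * x)) β).toReal := by
  have hv : 0 < v := ha.trans_le hav
  have hvx : 0 ≤ v * x := by positivity
  unfold buyerPotential
  split_ifs with hβ
  · simp only [hβ, add_zero, le_top, inf_of_le_left, ENNReal.toReal_ofReal hvx]
    linarith
  · have hap := hap hβ
    have hpβ' : p ≤ β.toReal := (ENNReal.ofReal_le_iff_le_toReal hβ).1 hpβ
    have hβv : v * (β.toReal / v) = β.toReal := mul_div_cancel₀ _ hv.ne'
    rw [ENNReal.toReal_min ENNReal.ofReal_ne_top hβ, ENNReal.toReal_ofReal hvx, add_zero, ← hβv,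
      ← mul_min_of_nonneg _ _ hv.le, hβv]
    set κ := β.toReal / v
    rcases le_total x κ with h | h
    · rw [min_eq_left h, max_eq_right (by linarith)]
      nlinarith
    · rw [min_eq_right h, max_eq_left (by linarith)]
      have h1 : a * (x - κ) ≤ (v - a) * κ := by nlinarith
      have h2 : ε * (x - κ) ≤ a * κ := by
        have hκ : 0 ≤ κ := by positivity
        have h3 : a * (ε * (x - κ)) ≤ a * (a * κ) := by
          calc a * (ε * (x - κ)) = ε * (a * (x - κ)) := by ring
            _ ≤ ε * ((v - a) * κ) := mul_le_mul_of_nonneg_left h1 hε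
            _ = ε * (v - a) * κ := by ring
            _ ≤ a ^ 2 * κ := mul_le_mul_of_nonneg_right hεa hκ
            _ = a * (a * κ) := by ring
        exact le_of_mul_le_mul_left h3 ha
      nlinarith

section Guarantee

variable {n m : ℕ} {G : Market (Fin n) (Fin m)} {v : Fin n → ℝ} {ρ : Fin m → ℝ}
  {B : Fin n → ℝ≥0∞} {ε a : ℝ}

theorem liquidWelfare_eq_sum_withKept (hρ : ∀ j, 0 ≤ ρ j) {A : Allocation (Fin n) (Fin m)}
    (hA : ∀ j, ∑ i, A.w i j ≤ G.f j (G.nbr j)) :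
    G.liquidWelfare v ρ B A = ∑ k, (min (ENNReal.ofReal (Sum.elim v ρ k *
      ∑ j, withKept G A.w k j)) ((Sum.elim B fun _ => ⊤ : _ → ℝ≥0∞) k)).toReal := by
  rw [Fintype.sum_sum_type, liquidWelfare]
  congr 1
  refine Finset.sum_congr rfl fun j _ => ?_
  have := mul_nonneg (hρ j) (sub_nonneg.2 (hA j))
  simp [withKept, ENNReal.toReal_ofReal this]

theorem exists_isOptLW (G : Market (Fin n) (Fin m)) (v : Fin n → ℝ) (ρ : Fin m → ℝ)
    (B : Fin n → ℝ≥0∞) : ∃ L, G.IsOptLW v ρ B L := by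
  have hmin : ∀ β : ℝ≥0∞, Continuous fun r : ℝ => (min (ENNReal.ofReal r) β).toReal := fun β =>
    ENNReal.continuousOn_toReal.comp_continuous (ENNReal.continuous_ofReal.min continuous_const)
      fun r => ne_top_of_le_ne_top ENNReal.ofReal_ne_top (min_le_left _ _)
  have happ : ∀ i j, Continuous fun w : Fin n → Fin m → ℝ => w i j := fun i j => by fun_prop
  have hcont : Continuous fun w : Fin n → Fin m → ℝ => G.liquidWelfare v ρ B ⟨w, 0, 0⟩ := by
    refine (continuous_finsetSum _ fun i _ => (hmin (B i)).comp ?_).add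
      (continuous_finsetSum _ fun j _ => ?_)
    · exact continuous_const.mul (continuous_finsetSum _ fun j _ => happ i j)
    · exact continuous_const.mul
        (continuous_const.sub (continuous_finsetSum _ fun i _ => happ i j))
  obtain ⟨w, hw, hmax⟩ := G.isCompact_polytope.exists_isMaxOn ⟨0, zero_mem_polytope G⟩
    hcont.continuousOn
  refine ⟨_, ⟨⟨w, 0, 0⟩, ⟨hw, fun _ => le_rfl, fun _ => le_rfl, fun i => by simp⟩, rfl⟩, ?_⟩
  rintro _ ⟨A, hA, rfl⟩
  exact hmax hA.1

/-- In the end everything is sold, either to a buyer or to the virtual buyer of the seller. -/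
theorem withKept_output {s : State (Fin n ⊕ Fin m) (Fin m)} (hw : s.w ∈ G.withVirtual.polytope)
    (hbase : ∃ u, G.withVirtual.IsBase s.w s.d u) (hd : ∀ i, s.d i = 0) :
    withKept G s.output.w = s.w := by
  obtain ⟨u, hu⟩ := hbase
  have hnbr : ∀ j, G.withVirtual.f j (G.withVirtual.nbr j) = G.f j (G.nbr j) := fun j => by
    simp [withVirtual]
  have hu0 : ∑ k, u k = 0 := Finset.sum_eq_zero fun k _ =>
    le_antisymm (by simpa [hd k] using hu.1.2 k) (hu.1.1.1 k)
  have hsold : ∀ j, ∑ k, s.w k j = G.f j (G.nbr j) := by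
    have h := hu.2.symm.trans hu0
    rw [supply_univ hw, Finset.sum_eq_zero_iff_of_nonneg fun j _ => ?_] at h
    · intro j
      have := h j (Finset.mem_univ j)
      rw [hnbr] at this
      linarith
    · have := hw.2.2 j _ subset_rfl
      rw [sum_nbr_eq hw.2.1] at this
      linarith
  ext k j
  rcases k with i | k
  · rfl
  · simp only [withKept, Sum.elim_inr]
    split_ifs with hkj
    · subst hkj
      have h := hsold k
      rw [Fintype.sum_sum_type, Finset.sum_eq_single (a := k) (s := Finset.univ)
        (f := fun l => s.w (Sum.inr l) k)
        (fun l _ hl => hw.2.1 _ _ (by simpa [withVirtual] using hl)) (by simp)] at h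
      simp only [State.output]
      linarith
    · exact (hw.2.1 _ _ (by simpa [withVirtual] using hkj)).symm

theorem half_le_of_outcome (hadm : Admissible v ρ ε) (ha : 0 < a)
    (hav : ∀ k, a ≤ Sum.elim v ρ k) (hεa : ∀ k, ε * (Sum.elim v ρ k - a) ≤ a ^ 2)
    {A A' : Allocation (Fin n) (Fin m)} (hA : Outcome G v ρ B ε A) (hA' : A'.w ∈ G.polytope) :
    1 / 2 * G.liquidWelfare v ρ B A' ≤ G.liquidWelfare v ρ B A := by
  obtain ⟨t, s, hs, hd, rfl⟩ := hA
  have hρ : ∀ j, 0 ≤ ρ j := fun j => (hadm.2 (Sum.inr j)).1.le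
  have hA'sum : ∀ j, ∑ i, A'.w i j ≤ G.f j (G.nbr j) := fun j => by
    have := hA'.2.2 j _ subset_rfl
    rwa [sum_nbr_eq hA'.2.1] at this
  have hinit : G.liquidWelfare v ρ B A' ≤ potential (Sum.elim v ρ) (Sum.elim B fun _ => ⊤) a ε
      (State.init (Fin n ⊕ Fin m) (Fin m)) fun k => ∑ j, withKept G A'.w k j := by
    rw [liquidWelfare_eq_sum_withKept hρ hA'sum]
    refine Finset.sum_le_sum fun k _ => ?_
    simpa [State.init] using le_buyerPotential_init (a := a) hadm.1.le (hadm.2 k).1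
      (Finset.sum_nonneg fun j _ => (withKept_mem_polytope hA').1 k j)
  obtain ⟨h1, -, u, hu, hL⟩ := hs.invariant hadm (fun j => hav (Sum.inr j))
    ⟨_, isBase_withKept hA', hinit⟩
  have hkept := withKept_output h1.mem_polytope ⟨u, hu⟩ hd
  have hsum : ∀ j, ∑ i, s.output.w i j ≤ G.f j (G.nbr j) := fun j => by
    rw [← sum_withKept G s.output.w j, hkept, Fintype.sum_sum_type]
    exact le_add_of_nonneg_right (Finset.sum_nonneg fun k _ => h1.mem_polytope.1 _ _)
  rw [liquidWelfare_eq_sum_withKept hρ hsum, hkept]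
  have hfinal : potential (Sum.elim v ρ) (Sum.elim B fun _ => ⊤) a ε s u ≤
      2 * ∑ k, (min (ENNReal.ofReal (Sum.elim v ρ k * ∑ j, s.w k j))
        ((Sum.elim B fun _ => ⊤ : _ → ℝ≥0∞) k)).toReal := by
    rw [Finset.mul_sum]
    refine Finset.sum_le_sum fun k _ => ?_
    have huk : u k = 0 := le_antisymm (by simpa [hd k] using hu.1.2 k) (hu.1.1.1 k)
    rw [huk]
    exact buyerPotential_final_le ha hadm.1.le (hav k) (hεa k)
      (Finset.sum_nonneg fun j _ => h1.mem_polytope.1 k j) (h1.p_le k) (h1.p_budget k)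
      (h1.le_p k)
  linarith

theorem vmin_le (k : Fin n ⊕ Fin m) : vmin v ρ ≤ Sum.elim v ρ k :=
  ciInf_le (Set.finite_range _).bddBelow k

theorem le_vmax (k : Fin n ⊕ Fin m) : Sum.elim v ρ k ≤ vmax v ρ :=
  le_ciSup (Set.finite_range (Sum.elim v ρ)).bddAbove k

theorem vmin_pos (hn : 0 < n) (hadm : Admissible v ρ ε) : 0 < vmin v ρ := by
  have : Nonempty (Fin n ⊕ Fin m) := ⟨Sum.inl ⟨0, hn⟩⟩
  obtain ⟨k, hk⟩ := exists_eq_ciInf_of_finite (f := Sum.elim v ρ)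
  rw [vmin, ← hk]
  exact (hadm.2 k).1

end Guarantee

end PCA

namespace PCA

open Market

/-! ### Tightness -/

section Tightness

/-- One seller with a single divisible good, to whom two buyers are adjacent. -/
def singleGoodMarket : Market (Fin 2) (Fin 1) where
  nbr _ := Finset.univ
  f _ S := if S = ∅ then 0 else 1
  f_empty := by simp
  f_mono j S T hST _ := by
    by_cases hT : T = ∅
    · subst hT
      simp [Finset.subset_empty.1 hST]
    · by_cases hS : S = ∅ <;> simp [hS, hT]
  f_submod j S T _ _ := by
    by_cases hS : S = ∅
    · simp [hS]
    · by_cases hT : T = ∅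
      · simp [hT]
      · have : S ∪ T ≠ ∅ := fun h => hS (Finset.union_eq_empty.1 h).1
        simp only [hS, hT, this, if_false]
        split_ifs <;> norm_num

theorem singleGoodMarket_f_univ (j : Fin 1) : singleGoodMarket.f j Finset.univ = 1 := by
  have h : (Finset.univ : Finset (Fin 2)) ≠ ∅ := Finset.univ_nonempty.ne_empty
  simp only [singleGoodMarket, h, if_false]

theorem singleGoodMarket_nbr (j : Fin 1) : singleGoodMarket.nbr j = Finset.univ := rfl

variable {ε a b : ℝ}

/-- The valuations in the tight example. The first buyer has an infinite budget. -/
def tightValuation (ε a b : ℝ) : Fin 2 → ℝ := ![a + ε, b]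

/-- The budgets in the tight example. The second buyer can pay exactly for the whole good at the
price `a`. -/
noncomputable def tightBudget (a : ℝ) : Fin 2 → ℝ≥0∞ := ![⊤, ENNReal.ofReal a]

theorem withVirtual_singleGoodMarket_f {F : Finset (Fin 2 ⊕ Fin 1)} (hF : F.Nonempty) (j : Fin 1) :
    singleGoodMarket.withVirtual.f j F = 1 := by
  by_cases hj : Sum.inr j ∈ F
  · simp [withVirtual, singleGoodMarket_nbr, singleGoodMarket_f_univ, hj]
  · have : F.toLeft ≠ ∅ := by
      obtain ⟨i | k, hx⟩ := hF
      · exact Finset.ne_empty_of_mem (Finset.mem_toLeft.2 hx)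
      · exact absurd (Subsingleton.elim k j ▸ hx) hj
    simp [withVirtual, singleGoodMarket, hj, this]

/-- Nobody clinches as long as somebody else demands the whole good. -/
theorem clinch_eq_zero_of_one_le_demand {d : Fin 2 ⊕ Fin 1 → ℝ≥0∞} {i k : Fin 2 ⊕ Fin 1}
    {ξ : Fin 1 → ℝ} (hξ : ξ ∈ singleGoodMarket.withVirtual.clinchPolytope 0 d i) (hki : k ≠ i)
    (hk : 1 ≤ d k) : ξ = 0 := by
  have hw : (0 : Fin 2 ⊕ Fin 1 → Fin 1 → ℝ) ∈ singleGoodMarket.withVirtual.polytope :=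
    mem_polytope_of_le (withKept_mem_polytope (zero_mem_polytope _)) (fun _ _ => le_rfl)
      (withKept_mem_polytope (zero_mem_polytope _)).1
  obtain ⟨h0, -, hP, -, hsub⟩ := (mem_clinchPolytope_iff hw).1 hξ
  have hr := isPolymatroidRank_supply hw
  have hmem : (Pi.single k 1 : Fin 2 ⊕ Fin 1 → ℝ) ∈ cappedPolymatroid
      (singleGoodMarket.withVirtual.supply 0) (Function.update d i 0) := by
    refine ⟨⟨fun l => ?_, fun S => ?_⟩, fun l => ?_⟩
    · by_cases h : l = k
      · subst h; simp
      · simp [h]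
    · rw [Finset.sum_pi_single']
      split_ifs with hS
      · rw [supply, Fin.sum_univ_one]
        obtain ⟨T, h1, h2, h3⟩ := exists_residualRank_eq singleGoodMarket.withVirtual 0 0 S
        have hT : T.Nonempty := ⟨k, h1 (Finset.mem_inter.2 ⟨hS, by
          rcases k with k | k
          · simp [withVirtual, singleGoodMarket_nbr]
          · simp [withVirtual, Subsingleton.elim k 0]⟩)⟩
        rw [h3, withVirtual_singleGoodMarket_f hT]
        simp
      · simpa [hr.empty] using hr.mono ∅ S (by simp)
    · by_cases h : l = k
      · subst h; simpa [hki] using hk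
      · simp [h]
  have h1 := (hsub hmem).1.2 {k}
  rw [Finset.sum_singleton, Pi.single_eq_same, supply, Fin.sum_univ_one] at h1
  have h2 := residualRank_le (G := singleGoodMarket.withVirtual)
    (w := Function.update (0 : Fin 2 ⊕ Fin 1 → Fin 1 → ℝ) i
      ((0 : Fin 2 ⊕ Fin 1 → Fin 1 → ℝ) i + ξ)) (j := 0) (S := {k})
    Finset.inter_subset_right subset_rfl
  rw [sum_nbr_eq hP.2.1, sum_update_add, if_pos (Finset.mem_univ i),
    withVirtual_singleGoodMarket_f ⟨Sum.inr 0, by simp [withVirtual]⟩] at h2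
  simp only [Pi.zero_apply, Finset.sum_const_zero, zero_add] at h1 h2
  ext j
  rw [Subsingleton.elim j 0]
  exact le_antisymm (by simp only [Pi.zero_apply]; linarith) (h0 0)

theorem clinch_eq_zero_of_demand_eq_zero {N M : Type} [Fintype N] [Fintype M] [DecidableEq N]
    {G : Market N M} {w : N → M → ℝ} {d : N → ℝ≥0∞} {i : N} {ξ : M → ℝ} (hw : w ∈ G.polytope)
    (hξ : ξ ∈ G.clinchPolytope w d i) (hd : d i = 0) : ξ = 0 := by
  obtain ⟨h0, -, -, hle, -⟩ := (mem_clinchPolytope_iff hw).1 hξ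
  have h : ∑ j, ξ j ≤ 0 := by simpa [hd] using hle
  ext j
  exact (Finset.sum_eq_zero_iff_of_nonneg fun j _ => h0 j).1
    (h.antisymm (Finset.sum_nonneg fun j _ => h0 j)) j (Finset.mem_univ j)

/-- In the tight example nothing is sold until the first buyer and the virtual buyer have dropped
out. The former drops out when her price reaches `a + ε`, while the price of the second buyer is
still `a`. -/
theorem Reach.tight_invariant (hε : 0 < ε) (ha : 0 < a) (hab : a < b) {K : ℕ} (hK : a = K * ε)
    {t : ℕ} {s : State (Fin 2 ⊕ Fin 1) (Fin 1)}
    (h : Reach singleGoodMarket.withVirtual (Sum.elim (tightValuation ε a b) fun _ => a)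
      (Sum.elim (tightBudget a) fun _ => ⊤) ε t s) :
    Consistent singleGoodMarket.withVirtual (Sum.elim (tightValuation ε a b) fun _ => a)
      (Sum.elim (tightBudget a) fun _ => ⊤) 0 s ∧ s.c = clock 2 1 ε t ∧
      (∀ i, i ≠ Sum.inl 1 → s.w i = 0) ∧ (t ≤ 3 * K + 1 → s.w = 0 ∧ s.p = 0) := by
  have hv : ∀ i, 0 < Sum.elim (tightValuation ε a b) (fun _ : Fin 1 => a) i := by
    rintro (i | j)
    · fin_cases i
      · simp [tightValuation]; linarith
      · simp [tightValuation]; linarith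
    · exact ha
  induction h with
  | init =>
    exact ⟨consistent_init hv, funext fun i => (clock_zero ε i).symm, fun _ _ => rfl,
      fun _ => ⟨rfl, rfl⟩⟩
  | @step t s s' l hs hd hc hl ih =>
    have hstep := hc.induction (P := fun r =>
      Consistent singleGoodMarket.withVirtual (Sum.elim (tightValuation ε a b) fun _ => a)
      (Sum.elim (tightBudget a) fun _ => ⊤) 0 r ∧ r.c = clock 2 1 ε t ∧
      (∀ i, i ≠ Sum.inl 1 → r.w i = 0) ∧ (t ≤ 3 * K → r.w = 0 ∧ r.p = 0)) ?_
      ⟨ih.1, ih.2.1, ih.2.2.1, fun ht => ih.2.2.2 (by omega)⟩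
    · obtain ⟨h1, h2, h3, h4⟩ := hstep
      refine ⟨h1.raise hε.le l, ?_, h3, fun ht => h4 (by omega)⟩
      rw [clock_succ ε hl, ← h2]
      rfl
    · rintro i r r' hr ⟨h1, h2, h3, h4⟩
      refine ⟨hr.consistent h1 fun _ _ _ => Or.inr (h1.c_nonneg i), hr.c_eq.trans h2, ?_⟩
      obtain ⟨ξ, hξ, rfl⟩ := hr
      have hcl : ∀ k, r.c k = ((t + 2 - (finSumFinEquiv k : ℕ)) / 3 : ℕ) * ε := fun k => by
        rw [h2, clock, show t + (2 + 1) - 1 = t + 2 by omega]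
      have hc0 : r.c (Sum.inl 0) = ((t + 2) / 3 : ℕ) * ε := hcl _
      have hc1 : r.c (Sum.inl 1) = ((t + 1) / 3 : ℕ) * ε := hcl _
      have hc2 : r.c (Sum.inr 0) = (t / 3 : ℕ) * ε := hcl _
      have hd0 := h1.d_eq (Sum.inl 0)
      have hd1 := h1.d_eq (Sum.inl 1)
      have hd2 := h1.d_eq (Sum.inr 0)
      by_cases ht : t ≤ 3 * K
      · obtain ⟨hw0, hp0⟩ := h4 ht
        have hz : ξ = 0 := by
          rw [hw0] at hξ
          by_cases hi : i = Sum.inl 0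
          · refine clinch_eq_zero_of_one_le_demand (k := Sum.inl 1) hξ.1 (by simp [hi]) ?_
            have hca : r.c (Sum.inl 1) ≤ a := by
              rw [hc1, hK]
              exact mul_le_mul_of_nonneg_right (Nat.cast_le.2 (by omega)) hε.le
            rw [hd1, demand, if_pos (by simpa [tightValuation] using hca.trans_lt hab), hp0]
            split_ifs with hc0
            · simp
            · have hpos := lt_of_le_of_ne (h1.c_nonneg (Sum.inl 1)) (Ne.symm hc0)
              rw [ENNReal.le_div_iff_mul_le (by simp [hpos]) (by simp)]
              simpa [tightBudget] using ENNReal.ofReal_le_ofReal hca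
          · refine clinch_eq_zero_of_one_le_demand (k := Sum.inl 0) hξ.1 (Ne.symm hi) ?_
            have hca : r.c (Sum.inl 0) < a + ε := by
              have h5 : (t + 2) / 3 ≤ K := by omega
              have h6 : (((t + 2) / 3 : ℕ) : ℝ) * ε ≤ K * ε :=
                mul_le_mul_of_nonneg_right (Nat.cast_le.2 h5) hε.le
              rw [hc0, hK]
              linarith
            rw [hd0, demand, if_pos (by simpa [tightValuation] using hca), hp0]
            split_ifs with hc0
            · simp
            · simp [tightBudget, ENNReal.top_div_of_ne_top]
        subst hz
        simp only [hw0, hp0]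
        simp
      · refine ⟨fun k hk => ?_, fun h => absurd h ht⟩
        by_cases hki : k = i
        · subst hki
          have hdk : r.d k = 0 := by
            rcases k with k | k
            · fin_cases k
              · have h5 : K + 1 ≤ (t + 2) / 3 := by omega
                have h6 : ((K + 1 : ℕ) : ℝ) * ε ≤ (((t + 2) / 3 : ℕ) : ℝ) * ε :=
                  mul_le_mul_of_nonneg_right (Nat.cast_le.2 h5) hε.le
                refine hd0.trans (if_neg ?_)
                rw [not_lt, hc0]
                push_cast at h6
                simp only [tightValuation, Sum.elim_inl, Matrix.cons_val_zero]
                linarith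
              · simp at hk
            · rw [Subsingleton.elim k 0]
              refine hd2.trans (if_neg ?_)
              rw [not_lt, hc2, hK]
              exact mul_le_mul_of_nonneg_right (Nat.cast_le.2 (by omega)) hε.le
          have hz := clinch_eq_zero_of_demand_eq_zero h1.mem_polytope hξ.1 hdk
          simp [hz, h3 k hk]
        · simpa [hki] using h3 k hk

theorem admissible_tight (hε : 0 < ε) (ha : 0 < a) (hab : a < b) (hK : ∃ k : ℕ, a = k * ε)
    (hK' : ∃ k : ℕ, b = k * ε) : Admissible (tightValuation ε a b) (fun _ : Fin 1 => a) ε := by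
  obtain ⟨K, hK⟩ := hK
  refine ⟨hε, ?_⟩
  rintro (i | j)
  · fin_cases i
    · exact ⟨add_pos ha hε, K + 1, by simp [tightValuation, hK]; ring⟩
    · exact ⟨ha.trans hab, hK'⟩
  · exact ⟨ha, K, hK⟩

theorem liquidWelfare_tight (ha : 0 < a) (hε : 0 < ε) (hb : 0 < b)
    {A : Allocation (Fin 2) (Fin 1)} (h0 : 0 ≤ A.w 0 0) (h1 : 0 ≤ A.w 1 0) :
    singleGoodMarket.liquidWelfare (tightValuation ε a b) (fun _ => a) (tightBudget a) A =
      (a + ε) * A.w 0 0 + min (b * A.w 1 0) a + a * (1 - (A.w 0 0 + A.w 1 0)) := by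
  have h2 : 0 ≤ (a + ε) * A.w 0 0 := by positivity
  have h3 : 0 ≤ b * A.w 1 0 := by positivity
  simp [liquidWelfare, tightValuation, tightBudget, Fin.sum_univ_two, singleGoodMarket_nbr,
    singleGoodMarket_f_univ, ENNReal.toReal_ofReal h2, ENNReal.toReal_min, ENNReal.toReal_ofReal h3,
    ENNReal.toReal_ofReal ha.le]

theorem isOptLW_tight (ha : 0 < a) (hε : 0 < ε) (hab : a + ε ≤ b) :
    singleGoodMarket.IsOptLW (tightValuation ε a b) (fun _ => a) (tightBudget a)
      (a + (a + ε) * (1 - a / b)) := by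
  have hb : 0 < b := by linarith
  have hdiv : 0 ≤ a / b := by positivity
  have hdiv1 : a / b ≤ 1 := (div_le_one hb).2 (by linarith)
  have hbb : b * (a / b) = a := mul_div_cancel₀ a hb.ne'
  constructor
  · refine ⟨⟨![fun _ => 1 - a / b, fun _ => a / b], 0, 0⟩, ⟨⟨fun i j => ?_, fun i j h => ?_,
      fun j F _ => ?_⟩, fun _ => le_rfl, fun _ => le_rfl, fun i => by simp⟩, ?_⟩
    · fin_cases i
      · simpa using hdiv1
      · simpa using hdiv
    · simp [singleGoodMarket] at h
    · by_cases hF : F = ∅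
      · simp [hF, singleGoodMarket]
      · refine (Finset.sum_le_sum_of_subset_of_nonneg (Finset.subset_univ F)
          fun i _ _ => ?_).trans (b := ∑ i : Fin 2, _) ?_
        · fin_cases i
          · simpa using hdiv1
          · simpa using hdiv
        · simp [singleGoodMarket, hF]
    · rw [liquidWelfare_tight ha hε hb (by simpa using hdiv1) (by simpa using hdiv)]
      simp [hbb]
      ring
  · rintro _ ⟨A, hA, rfl⟩
    have h0 := hA.1.1 0 0
    have h1 := hA.1.1 1 0
    have h2 := hA.1.2.2 0 Finset.univ subset_rfl
    rw [singleGoodMarket_f_univ, Fin.sum_univ_two] at h2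
    rw [liquidWelfare_tight ha hε hb h0 h1]
    rcases le_total (A.w 1 0) (a / b) with h | h
    · have := min_le_left (b * A.w 1 0) a
      nlinarith
    · have := min_le_right (b * A.w 1 0) a
      nlinarith

/-- In the tight example the second buyer gets the whole good and pays `a` for it. -/
theorem liquidWelfare_outcome_tight (hε : 0 < ε) (ha : 0 < a) (hab : a < b)
    (hK : ∃ k : ℕ, a = k * ε) (hK' : ∃ k : ℕ, b = k * ε) {A : Allocation (Fin 2) (Fin 1)}
    (hA : Outcome singleGoodMarket (tightValuation ε a b) (fun _ => a) (tightBudget a) ε A) :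
    singleGoodMarket.liquidWelfare (tightValuation ε a b) (fun _ => a) (tightBudget a) A = a := by
  have hadm := admissible_tight hε ha hab hK hK'
  obtain ⟨K, hK⟩ := hK
  obtain ⟨t, s, hs, hd, rfl⟩ := hA
  obtain ⟨h1, -, h3, -⟩ := hs.tight_invariant hε ha hab hK
  obtain ⟨-, -, u, hu, -⟩ := hs.invariant (a := 0) hadm (fun _ => ha.le)
    ⟨_, isBase_withKept (zero_mem_polytope _), le_rfl⟩
  have hkept := withKept_output h1.mem_polytope ⟨u, hu⟩ hd
  have hsum := sum_withKept singleGoodMarket s.output.w 0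
  have hw0 : s.w (Sum.inl 0) 0 = 0 := by rw [h3 _ (by simp)]; rfl
  have hw2 : s.w (Sum.inr 0) 0 = 0 := by rw [h3 _ (by simp)]; rfl
  have hw1 : s.w (Sum.inl 1) 0 = 1 := by
    rw [hkept, Fintype.sum_sum_type, Fin.sum_univ_two, Fin.sum_univ_one, hw0, hw2] at hsum
    simpa [singleGoodMarket_nbr, singleGoodMarket_f_univ] using hsum
  rw [liquidWelfare_tight ha hε (ha.trans hab) (by simp [State.output, hw0])
    (by simp [State.output, hw1])]
  simp [State.output, hw0, hw1, hab.le]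

end Tightness

end PCA

theorem theorem3p3 :
    -- the guarantee
    (∀ (n m : ℕ), 0 < n → 0 < m →
      ∀ (G : Market (Fin n) (Fin m)) (v : Fin n → ℝ) (ρ : Fin m → ℝ) (B : Fin n → ℝ≥0∞) (ε : ℝ),
        PCA.Admissible v ρ ε →
        ε * (PCA.vmax v ρ - PCA.vmin v ρ) ≤ PCA.vmin v ρ ^ 2 →
        ∃ OPT : ℝ, G.IsOptLW v ρ B OPT ∧
          (∃ A, PCA.Outcome G v ρ B ε A) ∧
          ∀ A, PCA.Outcome G v ρ B ε A → 1 / 2 * OPT ≤ G.liquidWelfare v ρ B A) ∧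
    -- tightness of the factor and of the condition on `ε`
    (∀ (ε a b : ℝ), 0 < ε → 0 < a → a < b → (∃ k : ℕ, a = k * ε) → (∃ k : ℕ, b = k * ε) →
      ∃ (G : Market (Fin 2) (Fin 1)) (v : Fin 2 → ℝ) (ρ : Fin 1 → ℝ) (B : Fin 2 → ℝ≥0∞) (OPT : ℝ),
        PCA.Admissible v ρ ε ∧ PCA.vmin v ρ = a ∧ PCA.vmax v ρ = b ∧
        G.IsOptLW v ρ B OPT ∧
        (∃ A, PCA.Outcome G v ρ B ε A) ∧
        ∀ A, PCA.Outcome G v ρ B ε A →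
          0 < G.liquidWelfare v ρ B A ∧
          (ε = a ^ 2 / (b - a) → G.liquidWelfare v ρ B A = 1 / 2 * OPT) ∧
          (a ^ 2 / (b - a) < ε → G.liquidWelfare v ρ B A < 1 / 2 * OPT)) := by
  constructor
  · intro n m hn _ G v ρ B ε hadm hcond
    obtain ⟨OPT, hOPT⟩ := PCA.exists_isOptLW G v ρ B
    refine ⟨OPT, hOPT, PCA.exists_outcome hn hadm, fun A hA => ?_⟩
    obtain ⟨A', hA', rfl⟩ := hOPT.1
    refine PCA.half_le_of_outcome hadm (PCA.vmin_pos hn hadm) PCA.vmin_le (fun k => ?_) hA hA'.1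
    exact (mul_le_mul_of_nonneg_left (sub_le_sub_right (PCA.le_vmax k) _) hadm.1.le).trans hcond
  · intro ε a b hε ha hab hK hK'
    have hadm := PCA.admissible_tight hε ha hab hK hK'
    have hab' : a + ε ≤ b := by
      obtain ⟨K, hK⟩ := hK
      obtain ⟨K', hK'⟩ := hK'
      have h1 : K < K' := by
        have : (K : ℝ) * ε < K' * ε := by rwa [← hK, ← hK']
        exact_mod_cast (mul_lt_mul_iff_left₀ hε).1 this
      have h2 : ((K + 1 : ℕ) : ℝ) * ε ≤ K' * ε :=
        mul_le_mul_of_nonneg_right (Nat.cast_le.2 h1) hε.le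
      push_cast at h2
      linarith
    have hbounds : ∀ k, a ≤ Sum.elim (PCA.tightValuation ε a b) (fun _ : Fin 1 => a) k ∧
        Sum.elim (PCA.tightValuation ε a b) (fun _ : Fin 1 => a) k ≤ b := by
      rintro (i | j)
      · fin_cases i
        · exact ⟨by simp [PCA.tightValuation, hε.le], hab'⟩
        · exact ⟨hab.le, le_rfl⟩
      · exact ⟨le_rfl, hab.le⟩
    refine ⟨PCA.singleGoodMarket, PCA.tightValuation ε a b, fun _ => a, PCA.tightBudget a, _, hadm,
      le_antisymm (PCA.vmin_le (Sum.inr 0)) (le_ciInf fun k => (hbounds k).1),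
      le_antisymm (ciSup_le fun k => (hbounds k).2)
        (PCA.le_vmax (v := PCA.tightValuation ε a b) (ρ := fun _ => a) (Sum.inl 1)),
      PCA.isOptLW_tight ha hε hab', PCA.exists_outcome two_pos hadm, fun A hA => ?_⟩
    rw [PCA.liquidWelfare_outcome_tight hε ha hab hK hK' hA]
    have hb : 0 < b := ha.trans hab
    have hba : 0 < b - a := sub_pos.2 hab
    have hfactor : 1 / 2 * (a + (a + ε) * (1 - a / b)) - a =
        (ε * (b - a) - a ^ 2) / (2 * b) := by
      field_simp
      ring
    refine ⟨ha, fun h => ?_, fun h => ?_⟩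
    · rw [h, div_mul_cancel₀ _ hba.ne', sub_self, zero_div] at hfactor
      rw [← h] at hfactor
      linarith
    · rw [div_lt_iff₀ hba] at h
      have : 0 < (ε * (b - a) - a ^ 2) / (2 * b) := div_pos (sub_pos.2 h) (by positivity)
      linarith
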